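/- Fix $n \ge 4$, put $v = n(n-3)/2$, and let $k, l : \mathbb R^2 \to \mathbb R$ be symmetric measurable kernels (for example $k=l=|x-y|$ or $k=l=|x-y|^2$). For all dimensions $p,q$ let $(X_1,Y_1),\dots,(X_n,Y_n)$ be i.i.d. copies of a random pair $(X,Y)$, $X=(x_1,\dots,x_p)\in\mathbb R^p$, $Y=(y_1,\dots,y_q)\in\mathbb R^q$, whose law may depend on $p,q$; write $x_{si}$, $y_{sj}$ for the coordinates of $X_s$, $Y_s$. For $s\ne t$ put $$k_{st}(i)=k(x_{si},x_{ti})-E[k(x_{si},x_{ti})\mid x_{si}]-E[k(x_{si},x_{ti})\mid x_{ti}]+E[k(x_{si},x_{ti})],$$ put $k_{ss}(i)=0$, and define $l_{st}(j)$ in the same way from $l$ and $y_{sj},y_{tj}$. Assume that $k(x_{si},x_{ti})$, $l(y_{sj},y_{tj})$ are integrable and $k_{st}(i)$, $l_{st}(j)$ square integrable for $s \neq t$ (for the kernels $|x-y|$ and $|x-y|^2$ this follows from D1 below). For an $n\times n$ matrix $A=(a_{st})$ let $\widetilde A$ be its $\mathcal U$-centered version: $\tilde a_{ss}=0$ and,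 for $s\neq t$, $$\tilde a_{st}=a_{st}-\tfrac1{n-2}\sum_{v'} a_{sv'}-\tfrac1{n-2}\sum_u a_{ut}+\tfrac1{(n-1)(n-2)}\sum_{u,v'}a_{uv'},$$ and let $(\widetilde A\cdot\widetilde B)=\frac1{n(n-3)}\sum_{s\ne t}\tilde a_{st}\tilde b_{st}$. With $\mathbf K(i)=(k_{st}(i))_{s,t}$ and $\mathbf L(j)=(l_{st}(j))_{s,t}$ define $$uCov_n^2(\mathbf X,\mathbf Y)=\frac1{\sqrt{pq}}\sum_{i=1}^p\sum_{j=1}^q(\widetilde{\mathbf K}(i)\cdot\widetilde{\mathbf L}(j)),$$ $uCov_n^2(\mathbf X,\mathbf X)$ (with $k$ twice) and $uCov_n^2(\mathbf Y,\mathbf Y)$ (with $l$ twice) likewise, and $$uCor_n^2=\frac{uCov_n^2(\mathbf X,\mathbf Y)}{\sqrt{uCov_n^2(\mathbf X,\mathbf X)\,uCov_n^2(\mathbf Y,\mathbf Y)}},\qquad T_u=\sqrt{v-1}\,\frac{uCor_n^2}{\sqrt{1-(uCor_n^2)^2}} .$$ Assume: (D1) there are constants $a,b,a',b'$, not depending on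 $p,q$, with $0<a\le \mathrm{var}(x_i)$, $E x_i^2\le b<\infty$, $0<a'\le \mathrm{var}(y_j)$ and $E y_j^2\le b'<\infty$ for all $i,j$ and all $p,q$; (D3) as $p\wedge q\to\infty$, the random vector $\big((p^{-1/2}\sum_{i} k_{st}(i))_{s<t},\,(q^{-1/2}\sum_{j} l_{st}(j))_{s<t}\big)$ converges in distribution to a jointly Gaussian vector $\big((c_{st})_{s<t},(d_{st})_{s<t}\big)$, and for all $s<t$ $$\mathrm{var}(c_{st})=\sigma_x^2=\lim\frac1p\sum_{i,j=1}^p\mathrm{cov}[k_{st}(i),k_{st}(j)],\qquad \mathrm{var}(d_{st})=\sigma_y^2=\lim\frac1q\sum_{i,j=1}^q\mathrm{cov}[l_{st}(i),l_{st}(j)],$$ $$\mathrm{cov}(c_{st},d_{st})=\sigma_{xy}^2=\lim\frac1{\sqrt{pq}}\sum_{i=1}^p\sum_{j=1}^q\mathrm{cov}[k_{st}(i),l_{st}(j)],$$ where $\sigma_x,\sigma_y>0$ and $\sigma_{xy}\in\mathbb R$ (so that $\sigma_{xy}^2\ge0$). Let $\phi=\sigma_{xy}^2/\sqrt{\sigma_x^2\sigma_y^2}$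 and suppose $\phi<1$. Then, as $p\wedge q\to\infty$, for every $t\in\mathbb R$: 1. if $X$ and $Y$ are independent (for all $p,q$), then $P(T_u\le t)\to P(t_{v-1}\le t)$; 2. in general, and in particular under the alternative that $X$ and $Y$ are dependent, $P(T_u\le t)\to E[P(t_{v-1,W}\le t)]$. Here $t_{v-1}$ is Student's $t$ distribution with $v-1$ degrees of freedom, $t_{v-1,w}$ is the noncentral $t$ distribution with $v-1$ degrees of freedom and noncentrality parameter $w$ (the law of $(Z+w)/\sqrt{V/(v-1)}$ with $Z\sim N(0,1)$ and $V\sim\chi^2_{v-1}$ independent), $\chi^2_v$ is the chi-square distribution with $v$ degrees of freedom, and $W\sim\sqrt{\frac{\phi^2}{1-\phi^2}\chi_v^2}$; the expectation is over $W$. -/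

import Mathlib

open MeasureTheory ProbabilityTheory Filter
open scoped Topology

noncomputable section

namespace HDIndep

/-! ### Reference distributions -/

/-- The chi-square distribution with `ν` degrees of freedom: the law of the sum of squares of
`ν` independent standard normal variables. -/
def chiSq (ν : ℕ) : Measure ℝ :=
  (Measure.pi (fun _ : Fin ν => gaussianReal 0 1)).map (fun z => ∑ i, z i ^ 2)

/-- Student's `t` distribution with `ν` degrees of freedom: the law of `Z / √(V / ν)` with
`Z` standard normal and `V` an independent chi-square variable with `ν` degrees of freedom. -/
def studentT (ν : ℕ) : Measure ℝ :=
  ((gaussianReal 0 1).prod (chiSq ν)).map (fun z => z.1 / √(z.2 / ν))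

/-- The noncentral `t` distribution with `ν` degrees of freedom and noncentrality parameter `w`:
the law of `(Z + w) / √(V / ν)` with `Z` standard normal and `V` an independent chi-square
variable with `ν` degrees of freedom. -/
def noncentralT (ν : ℕ) (w : ℝ) : Measure ℝ :=
  ((gaussianReal 0 1).prod (chiSq ν)).map (fun z => (z.1 + w) / √(z.2 / ν))

/-- The law of `W = √(φ² / (1 - φ²) · χ²_v)`. -/
def lawW (φ : ℝ) (v : ℕ) : Measure ℝ :=
  (chiSq v).map (fun x => √(φ ^ 2 / (1 - φ ^ 2) * x))

/-! ### The statistic -/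

/-- The degrees of freedom `v = n (n - 3) / 2` (the division is exact for `n ≥ 3`). -/
def dof (n : ℕ) : ℕ := n * (n - 3) / 2

/-- The `𝒰`-centered version of an `n × n` matrix. -/
def uCenter {n : ℕ} (A : Matrix (Fin n) (Fin n) ℝ) : Matrix (Fin n) (Fin n) ℝ :=
  Matrix.of fun s t =>
    if s = t then 0
    else A s t - 1 / ((n : ℝ) - 2) * ∑ v, A s v - 1 / ((n : ℝ) - 2) * ∑ u, A u t
      + 1 / (((n : ℝ) - 1) * ((n : ℝ) - 2)) * ∑ u, ∑ v, A u v

/-- The inner product `(n (n - 3))⁻¹ ∑_{s ≠ t} a_st b_st` of `𝒰`-centered matrices. -/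
def uInner {n : ℕ} (A B : Matrix (Fin n) (Fin n) ℝ) : ℝ :=
  1 / ((n : ℝ) * ((n : ℝ) - 3)) * ∑ s, ∑ t ∈ Finset.univ.erase s, A s t * B s t

section Statistic

variable {Ω : Type*} [MeasurableSpace Ω] {n p q : ℕ}

/-- The double centered kernel distances of a real sample `x₁, …, xₙ`: for `s ≠ t`,
`k_st = k(x_s, x_t) - E[k(x_s, x_t) | x_s] - E[k(x_s, x_t) | x_t] + E[k(x_s, x_t)]`,
and `k_ss = 0`. (If `k` is constant on the diagonal, like the distances `|x - y|` and
`|x - y|²`, the formula with `s = t` also gives `0` almost surely.) -/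
def kernelDist (P : Measure Ω) (k : ℝ → ℝ → ℝ) (x : Fin n → Ω → ℝ) (s t : Fin n) (ω : Ω) : ℝ :=
  if s = t then 0
  else
    k (x s ω) (x t ω)
      - (P[fun ω' => k (x s ω') (x t ω') | MeasurableSpace.comap (x s) inferInstance]) ω
      - (P[fun ω' => k (x s ω') (x t ω') | MeasurableSpace.comap (x t) inferInstance]) ω
      + ∫ ω', k (x s ω') (x t ω') ∂P

/-- The double centered kernel distances `k_st(i)` of the `i`-th coordinate of a sample of random
vectors, as a random matrix. -/
def kernelMat (P : Measure Ω) (k : ℝ → ℝ → ℝ) (X : Fin n → Ω → Fin p → ℝ) (i : Fin p) (ω : Ω) :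
    Matrix (Fin n) (Fin n) ℝ :=
  Matrix.of fun s t => kernelDist P k (fun r ω' => X r ω' i) s t ω

/-- The unified sample covariance `uCov²ₙ(𝐗, 𝐘)`, with kernel `k` for `𝐗` and `l` for `𝐘`. -/
def uCov (P : Measure Ω) (k l : ℝ → ℝ → ℝ) (X : Fin n → Ω → Fin p → ℝ)
    (Y : Fin n → Ω → Fin q → ℝ) (ω : Ω) : ℝ :=
  1 / √((p : ℝ) * (q : ℝ)) *
    ∑ i, ∑ j, uInner (uCenter (kernelMat P k X i ω)) (uCenter (kernelMat P l Y j ω))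

/-- The unified sample correlation `uCor²ₙ(𝐗, 𝐘)`. -/
def uCor (P : Measure Ω) (k l : ℝ → ℝ → ℝ) (X : Fin n → Ω → Fin p → ℝ)
    (Y : Fin n → Ω → Fin q → ℝ) (ω : Ω) : ℝ :=
  uCov P k l X Y ω / √(uCov P k k X X ω * uCov P l l Y Y ω)

/-- The studentized statistic `T_u`. -/
def studentized (P : Measure Ω) (k l : ℝ → ℝ → ℝ) (X : Fin n → Ω → Fin p → ℝ)
    (Y : Fin n → Ω → Fin q → ℝ) (ω : Ω) : ℝ :=
  √((dof n : ℝ) - 1) * (uCor P k l X Y ω / √(1 - uCor P k l X Y ω ^ 2))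

/-- `(X₁, Y₁), …, (Xₙ, Yₙ)` are independent and identically distributed pairs of random
vectors. (`X_s` and `Y_s` may depend on each other.) -/
structure IsIIDSample (P : Measure Ω) (X : Fin n → Ω → Fin p → ℝ)
    (Y : Fin n → Ω → Fin q → ℝ) : Prop where
  measurable_X : ∀ s, Measurable (X s)
  measurable_Y : ∀ s, Measurable (Y s)
  indep : iIndepFun (fun s ω => (X s ω, Y s ω)) P
  identDistrib : ∀ s t,
    IdentDistrib (fun ω => (X s ω, Y s ω)) (fun ω => (X t ω, Y t ω)) P P

end Statistic

/-! ### Assumptions on the array of samples, indexed by `d = (p, q)` -/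

section Assumptions

variable {n : ℕ} {Ω : ℕ × ℕ → Type*} [∀ d, MeasurableSpace (Ω d)]

/-- The coordinates of the vectors have variances bounded away from zero and bounded second
moments, uniformly in the coordinate and in the dimensions. -/
def BoundedMoments (P : ∀ d, Measure (Ω d)) {dim : ℕ × ℕ → ℕ}
    (X : ∀ d, Fin n → Ω d → Fin (dim d) → ℝ) : Prop :=
  ∃ a b : ℝ, 0 < a ∧ ∀ d s i,
    MemLp (fun ω => X d s ω i) 2 (P d) ∧
    a ≤ Var[fun ω => X d s ω i; P d] ∧
    ∫ ω, X d s ω i ^ 2 ∂(P d) ≤ b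

/-- The means and covariances of double centered kernel distances exist: `k(x_si, x_ti)` is
integrable and `k_st(i)` is square integrable. -/
def KernelMoments (P : ∀ d, Measure (Ω d)) (k : ℝ → ℝ → ℝ) {dim : ℕ × ℕ → ℕ}
    (X : ∀ d, Fin n → Ω d → Fin (dim d) → ℝ) : Prop :=
  ∀ d (s t : Fin n), s ≠ t → ∀ i,
    Integrable (fun ω => k (X d s ω i) (X d t ω i)) (P d) ∧
    MemLp (fun ω => kernelMat (P d) k (X d) i ω s t) 2 (P d)

/-- The index set `{(s, t) : s < t}`. -/
abbrev Pairs (n : ℕ) : Type := {e : Fin n × Fin n // e.1 < e.2}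

/-- The random vector `(p^{-1/2} ∑ᵢ k_st(i))_{s < t}`. -/
def normSum {Ω' : Type*} [MeasurableSpace Ω'] {p : ℕ} (P : Measure Ω') (k : ℝ → ℝ → ℝ)
    (X : Fin n → Ω' → Fin p → ℝ) (ω : Ω') : Pairs n → ℝ :=
  fun e => 1 / √(p : ℝ) * ∑ i, kernelMat P k X i ω e.1.1 e.1.2

/-- The central limit assumption: as `p ∧ q → ∞`, the vectors `(p^{-1/2} ∑ᵢ k_st(i))_{s < t}` and
`(q^{-1/2} ∑ⱼ l_uv(j))_{u < v}` converge jointly in distribution to a jointly Gaussian vector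
`(c_st, d_uv)`, whose covariances `var c_st = σ_x²`, `var d_st = σ_y²` and
`cov(c_st, d_st) = σ_xy²` are the limits of the corresponding covariances. -/
structure KernelCLT (P : ∀ d, Measure (Ω d)) [∀ d, IsProbabilityMeasure (P d)]
    (k l : ℝ → ℝ → ℝ) (X : ∀ d : ℕ × ℕ, Fin n → Ω d → Fin d.1 → ℝ)
    (Y : ∀ d : ℕ × ℕ, Fin n → Ω d → Fin d.2 → ℝ) (σx σy σxy : ℝ) : Prop where
  tendsto_gaussian :
    ∃ (γ : Measure ((Pairs n → ℝ) × (Pairs n → ℝ))) (_ : IsGaussian γ),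
      TendstoInDistribution
        (fun d ω => (normSum (P d) k (X d) ω, normSum (P d) l (Y d) ω))
        (atTop : Filter (ℕ × ℕ)) (fun z => z) P γ ∧
      ∀ e : Pairs n,
        Var[fun z => z.1 e; γ] = σx ^ 2 ∧
        Var[fun z => z.2 e; γ] = σy ^ 2 ∧
        cov[fun z => z.1 e, fun z => z.2 e; γ] = σxy ^ 2
  tendsto_x : ∀ s t : Fin n, s < t →
    Tendsto (fun d : ℕ × ℕ => 1 / (d.1 : ℝ) * ∑ i, ∑ j,
        cov[fun ω => kernelMat (P d) k (X d) i ω s t,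
          fun ω => kernelMat (P d) k (X d) j ω s t; P d])
      atTop (𝓝 (σx ^ 2))
  tendsto_y : ∀ s t : Fin n, s < t →
    Tendsto (fun d : ℕ × ℕ => 1 / (d.2 : ℝ) * ∑ i, ∑ j,
        cov[fun ω => kernelMat (P d) l (Y d) i ω s t,
          fun ω => kernelMat (P d) l (Y d) j ω s t; P d])
      atTop (𝓝 (σy ^ 2))
  tendsto_xy : ∀ s t : Fin n, s < t →
    Tendsto (fun d : ℕ × ℕ => 1 / √((d.1 : ℝ) * (d.2 : ℝ)) * ∑ i, ∑ j,
        cov[fun ω => kernelMat (P d) k (X d) i ω s t,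
          fun ω => kernelMat (P d) l (Y d) j ω s t; P d])
      atTop (𝓝 (σxy ^ 2))

end Assumptions

end HDIndep

end

open HDIndep

/-! Identify a symmetric matrix with zero diagonal with the vector of its entries above the
diagonal. Then 𝒰-centering is the orthogonal projection onto the matrices with zero row sums, a
space of dimension n(n-1)/2 - n = v (`uCenter_symMat`, `finrank_ker_rowSums`). In orthonormal
coordinates of that space the factor 1/v cancels, and T_u becomes √(v-1) a·b / √(|a|²|b|² - (a·b)²),
where a and b are the coordinate vectors of the two normalized sums (`studentized_eq_corStat`).

The assumed limit is Gaussian, but its mean and its covariances between different pairs are not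
given. Before the limit, the sums are centered, and sums over different pairs are uncorrelated: one
sample point occurs in only one of the two factors, and integrating it out gives 0. Convergence in
distribution alone does not carry moments to the limit, but the second moments converge exactly to
the limit variances. Fatou's lemma for f² then forces mean 0, and for (f ± g)² it forces covariance
0 (`integral_limit_eq_zero`, `covariance_limit_eq_zero`).

So in the limit a = σx A and b = σy (φ A + √(1-φ²) Z), with A and Z independent standard Gaussian
vectors in ℝ^v (`map_standardize`). Fix A and rotate so that its direction is the first axis: a·b
gives a normal variable shifted by φ|A|/√(1-φ²), and the Gram determinant gives an independent χ²
with v-1 degrees of freedom. This is a noncentral t law (`map_tStat`), and averaging over |A|² ~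
χ²_v gives the mixture. The portmanteau theorem applies because the discontinuities and the level
set of the statistic are null. If X and Y are independent, then σxy² = 0, so φ = 0 and W = 0. -/

namespace HDIndep

/-! ### 𝒰-centering as an orthogonal projection. -/

section LinearAlgebra

open Finset Matrix

variable {n : ℕ}

/-- The symmetric matrix with zero diagonal and prescribed entries above the diagonal. -/
noncomputable def symMat (c : Pairs n → ℝ) : Matrix (Fin n) (Fin n) ℝ :=
  Matrix.of fun s t =>
    if h : s < t then c ⟨(s, t), h⟩ else if h : t < s then c ⟨(t, s), h⟩ else 0

lemma symMat_of_lt (c : Pairs n → ℝ) {s t : Fin n} (h : s < t) :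
    symMat c s t = c ⟨(s, t), h⟩ := by
  simp [symMat, h]

lemma symMat_pair (c : Pairs n → ℝ) (e : Pairs n) : symMat c e.1.1 e.1.2 = c e :=
  symMat_of_lt c e.2

lemma symMat_comm (c : Pairs n → ℝ) (s t : Fin n) : symMat c s t = symMat c t s := by
  rcases lt_trichotomy s t with h | h | h
  · simp [symMat, h, h.not_gt]
  · rw [h]
  · simp [symMat, h, h.not_gt]

@[simp] lemma symMat_self (c : Pairs n → ℝ) (s : Fin n) : symMat c s s = 0 := by
  simp [symMat]

lemma eq_symMat {A : Matrix (Fin n) (Fin n) ℝ} (hA : ∀ s t, A s t = A t s)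
    (h0 : ∀ s, A s s = 0) : A = symMat fun e => A e.1.1 e.1.2 := by
  ext s t
  rcases lt_trichotomy s t with h | h | h
  · rw [symMat_of_lt _ h]
  · rw [h, h0, symMat_self]
  · rw [symMat_comm, symMat_of_lt _ h, hA]

lemma sum_erase_eq_two_mul_sum_pairs {f : Fin n → Fin n → ℝ} (hf : ∀ s t, f s t = f t s) :
    ∑ s, ∑ t ∈ univ.erase s, f s t = 2 * ∑ e : Pairs n, f e.1.1 e.1.2 := by
  have h1 : ∑ e : Pairs n, f e.1.1 e.1.2 = ∑ s, ∑ t, if s < t then f s t else 0 := by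
    rw [← Fintype.sum_prod_type' (f := fun s t => if s < t then f s t else 0), ← sum_filter,
      Finset.sum_subtype (p := fun e : Fin n × Fin n => e.1 < e.2)]
    simp
  have h2 : ∑ s, ∑ t, (if s < t then f s t else 0) = ∑ s, ∑ t, if t < s then f s t else 0 := by
    rw [sum_comm]
    exact sum_congr rfl fun s _ => sum_congr rfl fun t _ => by rw [hf]
  have h3 : 2 * ∑ e : Pairs n, f e.1.1 e.1.2
      = (∑ s, ∑ t, if s < t then f s t else 0) + ∑ s, ∑ t, if t < s then f s t else 0 := by
    rw [← h2, h1, two_mul]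
  rw [h3, ← sum_add_distrib]
  refine sum_congr rfl fun s _ => ?_
  rw [← sum_add_distrib, ← Finset.filter_ne', sum_filter]
  refine sum_congr rfl fun t _ => ?_
  rcases lt_trichotomy s t with h | h | h
  · simp [h, h.not_gt, h.ne']
  · simp [h]
  · simp [h, h.not_gt, h.ne]

lemma card_pairs : (Fintype.card (Pairs n) : ℝ) = n * (n - 1) / 2 := by
  have h := sum_erase_eq_two_mul_sum_pairs (n := n) (f := fun _ _ => 1) (fun _ _ => rfl)
  rcases Nat.eq_zero_or_pos n with rfl | hn
  · simp at h ⊢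
  · simp [Nat.cast_sub hn] at h
    linarith

lemma dof_cast (hn : 3 ≤ n) : (dof n : ℝ) = n * (n - 3) / 2 := by
  have h2 : 2 ∣ n * (n - 3) := by
    obtain ⟨m, rfl⟩ := Nat.exists_eq_add_of_le hn
    rw [Nat.add_sub_cancel_left, ← even_iff_two_dvd, Nat.even_mul, Nat.even_add]
    have : ¬ Even 3 := by decide
    tauto
  rw [dof, Nat.cast_div h2 (by norm_num)]
  push_cast [Nat.cast_sub hn]
  ring

/-- The row sums of the symmetric matrix with prescribed entries above the diagonal. -/
noncomputable def rowSums : EuclideanSpace ℝ (Pairs n) →ₗ[ℝ] Fin n → ℝ where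
  toFun c s := ∑ t, symMat c s t
  map_add' c d := by
    ext s
    simp only [Pi.add_apply, ← sum_add_distrib]
    refine sum_congr rfl fun t _ => ?_
    simp only [symMat, of_apply]
    split_ifs <;> simp
  map_smul' r c := by
    ext s
    simp only [Pi.smul_apply, smul_eq_mul, mul_sum, RingHom.id_apply]
    refine sum_congr rfl fun t _ => ?_
    simp only [symMat, of_apply]
    split_ifs <;> simp

/-- A preimage of `y` under `rowSums`. -/
noncomputable def ofRowSums (y : Fin n → ℝ) : EuclideanSpace ℝ (Pairs n) :=
  WithLp.toLp 2 fun e => 1 / ((n : ℝ) - 2) * y e.1.1 + 1 / ((n : ℝ) - 2) * y e.1.2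
    - 1 / (((n : ℝ) - 1) * ((n : ℝ) - 2)) * ∑ u, y u

lemma symMat_ofRowSums (y : Fin n → ℝ) {s t : Fin n} (hst : s ≠ t) :
    symMat (ofRowSums y) s t = 1 / ((n : ℝ) - 2) * y s + 1 / ((n : ℝ) - 2) * y t
      - 1 / (((n : ℝ) - 1) * ((n : ℝ) - 2)) * ∑ u, y u := by
  rcases hst.lt_or_gt with h | h
  · rw [symMat_of_lt _ h, ofRowSums]
  · rw [symMat_comm, symMat_of_lt _ h, ofRowSums]
    ring

lemma rowSums_ofRowSums (hn : 3 ≤ n) (y : Fin n → ℝ) : rowSums (ofRowSums y) = y := by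
  have hn' : (3 : ℝ) ≤ n := by exact_mod_cast hn
  ext s
  change ∑ t, symMat (ofRowSums y) s t = y s
  rw [← Finset.add_sum_erase _ _ (mem_univ s), symMat_self, zero_add,
    sum_congr rfl fun t ht => symMat_ofRowSums y (ne_of_mem_erase ht).symm]
  have h : ∑ t ∈ univ.erase s, y t = ∑ t, y t - y s := by
    rw [← Finset.add_sum_erase _ _ (mem_univ s)]; ring
  rw [sum_sub_distrib, sum_add_distrib, ← mul_sum _ y, h]
  simp only [sum_const, card_erase_of_mem (mem_univ s), card_univ, Fintype.card_fin,
    nsmul_eq_mul, Nat.cast_sub (by omega : 1 ≤ n), Nat.cast_one]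
  field_simp [show (n : ℝ) - 1 ≠ 0 by linarith, show (n : ℝ) - 2 ≠ 0 by linarith]
  ring

/-- Each term of `ofRowSums y` depends on at most one of the two indices, so summing over the other
index produces a row sum of `h`. -/
lemma inner_ofRowSums_eq_zero (y : Fin n → ℝ) {h : EuclideanSpace ℝ (Pairs n)}
    (hh : rowSums h = 0) : inner ℝ h (ofRowSums y) = 0 := by
  have hrow (s : Fin n) : ∑ t, symMat h s t = 0 := congrFun hh s
  have key := sum_erase_eq_two_mul_sum_pairs (n := n)
    (f := fun s t => symMat (ofRowSums y) s t * symMat h s t)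
    (fun s t => by rw [symMat_comm, symMat_comm h])
  have h1 : inner ℝ h (ofRowSums y)
      = ∑ e : Pairs n, symMat (ofRowSums y) e.1.1 e.1.2 * symMat h e.1.1 e.1.2 := by
    rw [PiLp.inner_apply]
    refine sum_congr rfl fun e _ => ?_
    rw [symMat_pair, symMat_pair]
    simp
  have h2 : ∑ s, ∑ t ∈ univ.erase s, symMat (ofRowSums y) s t * symMat h s t
      = ∑ s, ∑ t, (1 / ((n : ℝ) - 2) * y s + 1 / ((n : ℝ) - 2) * y t
      - 1 / (((n : ℝ) - 1) * ((n : ℝ) - 2)) * ∑ u, y u) * symMat h s t := by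
    refine sum_congr rfl fun s _ => ?_
    rw [← Finset.add_sum_erase univ _ (mem_univ s), symMat_self, mul_zero, zero_add]
    exact sum_congr rfl fun t ht => by rw [symMat_ofRowSums y (ne_of_mem_erase ht).symm]
  have h4 : ∑ s, ∑ t, y t * symMat h s t = 0 := by
    rw [sum_comm]
    simp [← mul_sum, hrow, symMat_comm h]
  have h6 : ∑ s, ∑ t, (1 / ((n : ℝ) - 2) * y s + 1 / ((n : ℝ) - 2) * y t
      - 1 / (((n : ℝ) - 1) * ((n : ℝ) - 2)) * ∑ u, y u) * symMat h s t = 0 := by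
    simp only [sub_mul, add_mul, sum_sub_distrib, sum_add_distrib, mul_assoc, ← mul_sum,
      h4, mul_zero, hrow]
    simp
  rw [h1]
  linarith

/-- The subtracted part has the same row sums as `c` and is orthogonal to the kernel of `rowSums`,
so 𝒰-centering is the orthogonal projection onto that kernel. -/
lemma uCenter_symMat (c : Pairs n → ℝ) :
    uCenter (symMat c) = symMat (WithLp.toLp 2 c - ofRowSums (rowSums (WithLp.toLp 2 c))) := by
  have hsym : ∀ s t : Fin n, s ≠ t → uCenter (symMat c) s t
      = symMat c s t - symMat (ofRowSums (rowSums (WithLp.toLp 2 c))) s t := by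
    intro s t hst
    rw [symMat_ofRowSums _ hst]
    have h1 (s : Fin n) : rowSums (WithLp.toLp 2 c) s = ∑ v, symMat c s v := rfl
    have h2 : ∑ u, symMat c u t = ∑ v, symMat c t v :=
      sum_congr rfl fun u _ => symMat_comm c u t
    simp only [uCenter, of_apply, if_neg hst, h1, h2]
    ring
  ext s t
  rcases lt_trichotomy s t with h | h | h
  · rw [hsym s t h.ne, symMat_of_lt _ h, symMat_of_lt _ h, symMat_of_lt _ h]
    simp
  · simp [h, uCenter]
  · rw [hsym s t h.ne', symMat_comm, symMat_of_lt _ h, symMat_comm (ofRowSums _),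
      symMat_of_lt _ h, symMat_comm, symMat_of_lt _ h]
    simp

lemma finrank_ker_rowSums (hn : 3 ≤ n) :
    Module.finrank ℝ (LinearMap.ker (rowSums (n := n))) = dof n := by
  have hsurj : LinearMap.range (rowSums (n := n)) = ⊤ :=
    LinearMap.range_eq_top.2 fun y => ⟨_, rowSums_ofRowSums hn y⟩
  have h := LinearMap.finrank_range_add_finrank_ker (rowSums (n := n))
  rw [hsurj, finrank_top, Module.finrank_fin_fun, finrank_euclideanSpace] at h
  have h' : (n : ℝ) + Module.finrank ℝ (LinearMap.ker (rowSums (n := n)))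
      = Fintype.card (Pairs n) := by exact_mod_cast h
  rw [card_pairs] at h'
  have h2 := dof_cast hn
  have : (Module.finrank ℝ (LinearMap.ker (rowSums (n := n))) : ℝ) = dof n := by
    rw [h2]; linarith
  exact_mod_cast this

/-- The inner product of `𝒰`-centered matrices is an inner product of `dof n` orthonormal
coordinates. -/
theorem exists_orthonormal_coordinates (hn : 4 ≤ n) :
    ∃ W : Matrix (Fin (dof n)) (Pairs n) ℝ, W * Wᵀ = 1 ∧ ∀ c d : Pairs n → ℝ,
      uInner (uCenter (symMat c)) (uCenter (symMat d))
        = (dof n : ℝ)⁻¹ * ((W *ᵥ c) ⬝ᵥ (W *ᵥ d)) := by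
  have hn3 : 3 ≤ n := by omega
  set H := LinearMap.ker (rowSums (n := n))
  let b : OrthonormalBasis (Fin (dof n)) ℝ H :=
    (stdOrthonormalBasis ℝ H).reindex (finCongr (finrank_ker_rowSums hn3))
  let p (c : Pairs n → ℝ) : EuclideanSpace ℝ (Pairs n) :=
    WithLp.toLp 2 c - ofRowSums (rowSums (WithLp.toLp 2 c))
  have hp (c) : p c ∈ H := by
    simp only [H, LinearMap.mem_ker, p, map_sub, rowSums_ofRowSums hn3, sub_self]
  -- The basis vectors lie in the kernel, so pairing with them ignores the centering correction: the
  -- coordinates can be read off the uncentered entries.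
  have hb (i) (c : Pairs n → ℝ) : inner ℝ (b i : EuclideanSpace ℝ (Pairs n)) (p c)
      = ∑ e, (b i : EuclideanSpace ℝ (Pairs n)) e * c e := by
    rw [inner_sub_right, inner_ofRowSums_eq_zero _ (b i).2, sub_zero, PiLp.inner_apply]
    exact sum_congr rfl fun e _ => by simp [mul_comm]
  refine ⟨Matrix.of fun i e => (b i : EuclideanSpace ℝ (Pairs n)) e, ?_, fun c d => ?_⟩
  · ext i j
    have := orthonormal_iff_ite.1 b.orthonormal j i
    rw [Submodule.coe_inner, PiLp.inner_apply] at this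
    rw [Matrix.mul_apply, Matrix.one_apply]
    simpa [eq_comm] using this
  · have h1 := b.sum_inner_mul_inner ⟨p c, hp c⟩ ⟨p d, hp d⟩
    simp only [Submodule.coe_inner] at h1
    have h2 : ∑ i, inner ℝ (p c) (b i : EuclideanSpace ℝ (Pairs n))
        * inner ℝ (b i : EuclideanSpace ℝ (Pairs n)) (p d)
        = ((Matrix.of fun i e => (b i : EuclideanSpace ℝ (Pairs n)) e) *ᵥ c) ⬝ᵥ
          ((Matrix.of fun i e => (b i : EuclideanSpace ℝ (Pairs n)) e) *ᵥ d) := by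
      refine sum_congr rfl fun i _ => ?_
      rw [real_inner_comm, hb, hb]
      rfl
    rw [← h2, h1, uInner, uCenter_symMat, uCenter_symMat,
      sum_erase_eq_two_mul_sum_pairs (fun s t => by
        rw [symMat_comm, symMat_comm (WithLp.toLp 2 d - _).ofLp]), dof_cast hn3,
      PiLp.inner_apply]
    simp only [symMat_pair]
    have : ∑ e, (p c) e * (p d) e = ∑ i, inner ℝ (p c i) (p d i) :=
      sum_congr rfl fun e _ => by simp [mul_comm]
    -- Each pair is counted twice in the sum over s ≠ t, and 2 / (n(n-3)) = 1 / v.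
    rw [← this, ← mul_assoc]
    congr 1
    rw [inv_div]
    ring

end LinearAlgebra

/-! ### Standard Gaussian vectors and the noncentral t law. -/

section Gaussian

open Matrix

variable {ι κ : Type*} [Fintype ι]

/-- The standard Gaussian measure on `ι → ℝ`. -/
noncomputable abbrev stdPi (ι : Type*) [Fintype ι] : Measure (ι → ℝ) :=
  Measure.pi fun _ => gaussianReal 0 1

lemma map_eq_stdPi_of_covariance {Ω : Type*} [MeasurableSpace Ω] {μ : Measure Ω}
    {X : Ω → ι → ℝ} (hX : HasGaussianLaw X μ) (hmean : ∀ i, ∫ ω, X ω i ∂μ = 0)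
    (hvar : ∀ i, Var[fun ω => X ω i; μ] = 1)
    (hcov : ∀ i j, i ≠ j → cov[fun ω => X ω i, fun ω => X ω j; μ] = 0) :
    μ.map X = stdPi ι := by
  have := hX.isProbabilityMeasure
  have hind : iIndepFun (fun i ω => X ω i) μ :=
    HasGaussianLaw.iIndepFun_of_covariance_eq_zero hX hcov
  have h := (iIndepFun_iff_map_fun_eq_pi_map fun i => hX.aemeasurable.eval i).1 hind
  refine h.trans ?_
  congr 1
  ext1 i
  rw [(hX.eval i).map_eq_gaussianReal, hmean, hvar]
  simp

lemma hasGaussianLaw_stdPi : HasGaussianLaw (fun z : ι → ℝ => z) (stdPi ι) :=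
  iIndepFun.hasGaussianLaw (X := fun i (z : ι → ℝ) => z i)
    (fun i => ((measurePreserving_eval (fun _ : ι => gaussianReal 0 1) i).hasLaw).hasGaussianLaw)
    (iIndepFun_pi (X := fun _ x => x) fun _ => aemeasurable_id)

lemma integral_eval_stdPi (i : ι) : ∫ z, z i ∂(stdPi ι) = 0 := by
  have h := (measurePreserving_eval (fun _ : ι => gaussianReal 0 1) i).hasLaw.integral_eq
  rw [integral_id_gaussianReal] at h
  exact h

lemma covariance_eval_stdPi [DecidableEq ι] (i j : ι) :
    cov[fun z => z i, fun z => z j; stdPi ι] = (1 : Matrix ι ι ℝ) i j := by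
  by_cases hij : i = j
  · subst hij
    rw [Matrix.one_apply_eq, covariance_self (measurable_pi_apply i).aemeasurable]
    have h := (measurePreserving_eval (fun _ : ι => gaussianReal 0 1) i).hasLaw.variance_eq
    rw [variance_id_gaussianReal] at h
    exact h
  · rw [Matrix.one_apply_ne hij]
    have hind : iIndepFun (fun i (z : ι → ℝ) => z i) (stdPi ι) :=
      iIndepFun_pi (X := fun _ x => x) fun _ => aemeasurable_id
    exact (hind.indepFun hij).covariance_eq_zero
      (hasGaussianLaw_stdPi.eval i).memLp_two (hasGaussianLaw_stdPi.eval j).memLp_two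

/-- Covariances of linear images of an uncorrelated square integrable vector pair. -/
lemma covariance_mulVec [DecidableEq ι] {Ω : Type*} [MeasurableSpace Ω] {μ : Measure Ω}
    [IsFiniteMeasure μ] {X Y : Ω → ι → ℝ} (hX : ∀ i, MemLp (fun ω => X ω i) 2 μ)
    (hY : ∀ i, MemLp (fun ω => Y ω i) 2 μ) {r : ℝ}
    (hcov : ∀ i j, cov[fun ω => X ω i, fun ω => Y ω j; μ] = r * (1 : Matrix ι ι ℝ) i j)
    (U V : Matrix κ ι ℝ) (i j : κ) :
    cov[fun ω => (U *ᵥ X ω) i, fun ω => (V *ᵥ Y ω) j; μ] = r * (U * Vᵀ) i j := by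
  simp only [mulVec, dotProduct]
  rw [covariance_fun_sum_fun_sum (fun e => (hX e).const_mul _) (fun e => (hY e).const_mul _)]
  simp only [covariance_const_mul_left, covariance_const_mul_right, hcov, mul_apply,
    Finset.mul_sum, transpose_apply]
  refine Finset.sum_congr rfl fun e _ => ?_
  rw [Finset.sum_eq_single e (fun f _ hf => by rw [one_apply_ne hf.symm]; ring) (by simp),
    one_apply_eq]
  ring

lemma map_mulVec_stdPi [Fintype κ] [DecidableEq κ] {U : Matrix κ ι ℝ} (hU : U * Uᵀ = 1) :
    (stdPi ι).map (fun z => U *ᵥ z) = stdPi κ := by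
  classical
  have hc (i j : κ) : cov[fun z => (U *ᵥ z) i, fun z => (U *ᵥ z) j; stdPi ι]
      = (1 : Matrix κ κ ℝ) i j := by
    rw [covariance_mulVec (X := fun z => z) (Y := fun z => z) (r := 1)
      (fun i => (hasGaussianLaw_stdPi.eval i).memLp_two)
      (fun i => (hasGaussianLaw_stdPi.eval i).memLp_two)
      (fun i j => by rw [covariance_eval_stdPi, one_mul]), hU, one_mul]
  have hm (i : κ) : Measurable fun z : ι → ℝ => (U *ᵥ z) i := by
    simp only [mulVec, dotProduct]; fun_prop
  refine map_eq_stdPi_of_covariance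
    (hasGaussianLaw_stdPi.map_fun (LinearMap.toContinuousLinearMap U.mulVecLin)) ?_ ?_ ?_
  · intro i
    simp only [mulVec, dotProduct]
    rw [integral_finsetSum _ fun e _ =>
      ((hasGaussianLaw_stdPi.eval e).integrable.const_mul _)]
    simp [integral_const_mul, integral_eval_stdPi]
  · intro i
    rw [← covariance_self (hm i).aemeasurable, hc, one_apply_eq]
  · intro i j hij
    rw [hc, one_apply_ne hij]

lemma stdPi_eval_eq (i : ι) (x : ℝ) : stdPi ι {z | z i = x} = 0 := by
  have h := (measurePreserving_eval (fun _ : ι => gaussianReal 0 1) i).measure_preimage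
    (measurableSet_singleton x).nullMeasurableSet
  have : NullSingletonClass (gaussianReal 0 1) := nullSingletonClass_gaussianReal one_ne_zero
  rw [measure_singleton] at h
  exact h

lemma measurable_sum_sq : Measurable fun z : ι → ℝ => ∑ i, z i ^ 2 := by fun_prop

instance (m : ℕ) : IsProbabilityMeasure (chiSq m) :=
  Measure.isProbabilityMeasure_map measurable_sum_sq.aemeasurable

lemma chiSq_zero {m : ℕ} (hm : m ≠ 0) : chiSq m {0} = 0 := by
  obtain ⟨k, rfl⟩ := Nat.exists_eq_succ_of_ne_zero hm
  rw [chiSq, Measure.map_apply measurable_sum_sq (measurableSet_singleton 0)]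
  refine measure_mono_null (fun z hz => ?_) (stdPi_eval_eq (0 : Fin (k + 1)) 0)
  have hz' := (Finset.sum_eq_zero_iff_of_nonneg fun i _ => sq_nonneg (z i)).1 hz
  exact pow_eq_zero_iff two_ne_zero |>.1 (hz' 0 (Finset.mem_univ _))

lemma chiSq_nonneg (m : ℕ) : ∀ᵐ x ∂(chiSq m), 0 ≤ x := by
  rw [chiSq, ae_map_iff measurable_sum_sq.aemeasurable measurableSet_Ici]
  exact .of_forall fun z => Finset.sum_nonneg fun _ _ => sq_nonneg _

lemma measurable_noncentral (m : ℕ) :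
    Measurable fun x : ℝ × ℝ × ℝ => (x.2.1 + x.1) / √(x.2.2 / m) := by fun_prop

/-- Given a positive value of the chi-square variable, the event pins the normal variable to a
single point. For `m = 0` the law is a point mass. -/
lemma noncentralT_singleton {m : ℕ} (hm : m ≠ 0) (w t : ℝ) : noncentralT m w {t} = 0 := by
  have hmeas : Measurable fun z : ℝ × ℝ => (z.1 + w) / √(z.2 / m) := by fun_prop
  rw [noncentralT, Measure.map_apply hmeas (measurableSet_singleton t),
    Measure.prod_apply_symm (hmeas (measurableSet_singleton t)), lintegral_eq_zero_iff'
      (measurable_measure_prodMk_right (hmeas (measurableSet_singleton t))).aemeasurable]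
  have h0 : ∀ᵐ y ∂(chiSq m), y ≠ 0 := by
    rw [ae_iff]; simpa using chiSq_zero hm
  filter_upwards [h0, chiSq_nonneg m] with y hy hy'
  have hpos : 0 < √(y / m) := by
    have : 0 < y := lt_of_le_of_ne hy' hy.symm
    have : (0 : ℝ) < m := by exact_mod_cast Nat.pos_of_ne_zero hm
    positivity
  have : NullSingletonClass (gaussianReal 0 1) := nullSingletonClass_gaussianReal one_ne_zero
  refine measure_mono_null (fun x hx => ?_) (measure_singleton (t * √(y / m) - w))
  have hx' : (x + w) / √(y / m) = t := hx
  rw [div_eq_iff hpos.ne'] at hx'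
  simp only [Set.mem_singleton_iff]
  linarith

/-- The limiting `t` statistic of two vectors `a` and `√(1 - φ²) z + φ a`, with
`r = φ / √(1 - φ²)`. -/
noncomputable def tStat (m : ℕ) (r : ℝ) (a z : ι → ℝ) : ℝ :=
  √m * ((r * (a ⬝ᵥ a) + a ⬝ᵥ z) / √((a ⬝ᵥ a) * (z ⬝ᵥ z) - (a ⬝ᵥ z) ^ 2))

lemma measurable_tStat (m : ℕ) (r : ℝ) :
    Measurable fun x : (ι → ℝ) × (ι → ℝ) => tStat m r x.1 x.2 := by
  unfold tStat dotProduct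
  fun_prop

lemma measurable_tStat_right (m : ℕ) (r : ℝ) (a : ι → ℝ) : Measurable (tStat m r a) := by
  unfold tStat dotProduct
  fun_prop

lemma dotProduct_self_pos {a : ι → ℝ} (ha : a ≠ 0) : 0 < a ⬝ᵥ a :=
  lt_of_le_of_ne (Finset.sum_nonneg fun _ _ => mul_self_nonneg _)
    fun h => ha (dotProduct_self_eq_zero.1 h.symm)

/-- Extend the unit vector a/|a| to an orthonormal basis and use the basis vectors as rows. -/
lemma exists_orthogonal_row {m : ℕ} {a : Fin (m + 1) → ℝ} (ha : a ≠ 0) :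
    ∃ U : Matrix (Fin (m + 1)) (Fin (m + 1)) ℝ, U * Uᵀ = 1 ∧
      ∀ z, √(a ⬝ᵥ a) * (U *ᵥ z) 0 = a ⬝ᵥ z := by
  have hpos := dotProduct_self_pos ha
  let u : EuclideanSpace ℝ (Fin (m + 1)) := WithLp.toLp 2 fun i => (√(a ⬝ᵥ a))⁻¹ * a i
  have hu : inner ℝ u u = 1 := by
    have : ∑ i, a i * a i = a ⬝ᵥ a := rfl
    have h2 : (√(a ⬝ᵥ a))⁻¹ * (√(a ⬝ᵥ a))⁻¹ * (a ⬝ᵥ a) = 1 := by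
      rw [← mul_inv, Real.mul_self_sqrt hpos.le, inv_mul_cancel₀ hpos.ne']
    rw [PiLp.inner_apply, ← h2, ← this, Finset.mul_sum]
    refine Finset.sum_congr rfl fun i _ => ?_
    exact mul_mul_mul_comm _ _ _ _
  have hv : Orthonormal ℝ (({0} : Set (Fin (m + 1))).domRestrict fun _ => u) := by
    constructor
    · rintro ⟨i, hi⟩
      have := real_inner_self_eq_norm_sq u
      rw [hu] at this
      change ‖u‖ = 1
      nlinarith [norm_nonneg u]
    · rintro ⟨i, hi⟩ ⟨j, hj⟩ hij
      exact absurd (Subtype.ext ((show i = 0 from hi).trans (show j = 0 from hj).symm)) hij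
  obtain ⟨b, hb⟩ := hv.exists_orthonormalBasis_extension_of_card_eq (by simp)
  refine ⟨Matrix.of fun i j => b i j, ?_, fun z => ?_⟩
  · ext i j
    have := orthonormal_iff_ite.1 b.orthonormal j i
    rw [PiLp.inner_apply] at this
    rw [Matrix.mul_apply, Matrix.one_apply]
    simpa [eq_comm] using this
  · simp only [mulVec, dotProduct, of_apply, hb 0 rfl, u, Finset.mul_sum]
    refine Finset.sum_congr rfl fun i _ => ?_
    rw [← mul_assoc, ← mul_assoc, mul_inv_cancel₀, one_mul]
    exact (Real.sqrt_pos.2 hpos).ne'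

lemma dotProduct_mulVec_self {U : Matrix ι ι ℝ} [DecidableEq ι] (hU : U * Uᵀ = 1) (z : ι → ℝ) :
    (U *ᵥ z) ⬝ᵥ (U *ᵥ z) = z ⬝ᵥ z := by
  rw [dotProduct_mulVec, vecMul_mulVec, mul_eq_one_comm.1 hU, vecMul_one]

/-- With y = U z, where the first row of U is a/|a|, one has a·z = |a| y₀, and the Gram determinant
is |a|² times the sum of the other yᵢ². The vector y is again standard Gaussian, so numerator and
denominator are independent. For `m = 0` the Gram determinant vanishes identically. -/
lemma map_tStat {m : ℕ} {r : ℝ} (hr : 0 ≤ r) {a : Fin (m + 1) → ℝ} (ha : a ≠ 0) :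
    (stdPi (Fin (m + 1))).map (tStat m r a) = noncentralT m √(r ^ 2 * ∑ i, a i ^ 2) ∧
    (m ≠ 0 → stdPi (Fin (m + 1)) {z | (a ⬝ᵥ a) * (z ⬝ᵥ z) - (a ⬝ᵥ z) ^ 2 = 0} = 0) := by
  have hpos := dotProduct_self_pos ha
  obtain ⟨U, hU, hU0⟩ := exists_orthogonal_row ha
  set ρ := √(a ⬝ᵥ a) with hρ
  have hρpos : 0 < ρ := Real.sqrt_pos.2 hpos
  have hρ2 : a ⬝ᵥ a = ρ ^ 2 := (Real.sq_sqrt hpos.le).symm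
  have hsum : ∑ i, a i ^ 2 = ρ ^ 2 := by
    rw [← hρ2]
    exact Finset.sum_congr rfl fun i _ => pow_two _
  have hw : √(r ^ 2 * ∑ i, a i ^ 2) = r * ρ := by
    rw [hsum, ← mul_pow, Real.sqrt_sq (by positivity)]
  have hz (z : Fin (m + 1) → ℝ) :
      z ⬝ᵥ z = (U *ᵥ z) 0 ^ 2 + ∑ i : Fin m, (U *ᵥ z) i.succ ^ 2 := by
    rw [← dotProduct_mulVec_self hU, dotProduct, Fin.sum_univ_succ, pow_two]
    simp only [pow_two]
  have hdisc (z : Fin (m + 1) → ℝ) : (a ⬝ᵥ a) * (z ⬝ᵥ z) - (a ⬝ᵥ z) ^ 2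
      = ρ ^ 2 * ∑ i : Fin m, (U *ᵥ z) i.succ ^ 2 := by
    rw [hz z, hρ2, ← hU0]
    ring
  have hmU : Measurable fun z : Fin (m + 1) → ℝ => U *ᵥ z := by
    unfold mulVec dotProduct
    fun_prop
  rw [hw]
  constructor
  · let g : (Fin (m + 1) → ℝ) → ℝ := fun y =>
      (y 0 + r * ρ) / √((∑ i : Fin m, y i.succ ^ 2) / m)
    have hg : Measurable g := by fun_prop
    have hcomp : tStat m r a = g ∘ fun z => U *ᵥ z := by
      ext z
      have hs : √(ρ ^ 2 * ∑ i : Fin m, (U *ᵥ z) i.succ ^ 2)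
          = ρ * √(∑ i : Fin m, (U *ᵥ z) i.succ ^ 2) := by
        rw [Real.sqrt_mul (sq_nonneg _), Real.sqrt_sq hρpos.le]
      have hnum : r * ρ ^ 2 + ρ * (U *ᵥ z) 0 = ρ * ((U *ᵥ z) 0 + r * ρ) := by ring
      simp only [tStat, Function.comp, g]
      rw [hdisc, hs, hρ2, ← hU0, hnum, mul_div_mul_left _ _ hρpos.ne',
        Real.sqrt_div (Finset.sum_nonneg fun _ _ => sq_nonneg _), div_div_eq_mul_div]
      ring
    let e := MeasurableEquiv.piFinSuccAbove (fun _ : Fin (m + 1) => ℝ) 0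
    have he : MeasurePreserving e (stdPi (Fin (m + 1)))
        ((gaussianReal 0 1).prod (stdPi (Fin m))) :=
      measurePreserving_piFinSuccAbove (fun _ : Fin (m + 1) => gaussianReal 0 1) 0
    let f : ℝ × ℝ → ℝ := fun x => (x.1 + r * ρ) / √(x.2 / m)
    have hf : Measurable f := by fun_prop
    have hge : g = f ∘ (Prod.map id fun y : Fin m → ℝ => ∑ i, y i ^ 2) ∘ e := by
      ext y
      simp [g, f, e, MeasurableEquiv.piFinSuccAbove, Fin.tail]
    have hmid : Measurable (Prod.map id fun y : Fin m → ℝ => ∑ i, y i ^ 2 : ℝ × _ → ℝ × ℝ) :=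
      measurable_id.prodMap measurable_sum_sq
    rw [hcomp, ← Measure.map_map hg hmU, map_mulVec_stdPi hU, hge,
      ← Measure.map_map hf (hmid.comp e.measurable), ← Measure.map_map hmid e.measurable,
      he.map_eq, ← Measure.map_prod_map _ _ measurable_id measurable_sum_sq, Measure.map_id]
    rfl
  · intro hm
    obtain ⟨k, rfl⟩ := Nat.exists_eq_succ_of_ne_zero hm
    -- A vanishing Gram determinant forces every rotated coordinate after the first to be 0; the one
    -- with index 1 already makes this a null event.
    have h0 := stdPi_eval_eq (ι := Fin (k + 1 + 1)) (Fin.succ 0) 0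
    rw [← map_mulVec_stdPi hU,
      Measure.map_apply hmU (measurableSet_eq_fun (by fun_prop) (by fun_prop))] at h0
    refine measure_mono_null (fun y hy => ?_) h0
    have hy' : (a ⬝ᵥ a) * (y ⬝ᵥ y) - (a ⬝ᵥ y) ^ 2 = 0 := hy
    rw [hdisc, mul_eq_zero_iff_left (by positivity)] at hy'
    have := (Finset.sum_eq_zero_iff_of_nonneg fun i _ => sq_nonneg ((U *ᵥ y) (Fin.succ i))).1 hy'
    exact pow_eq_zero_iff two_ne_zero |>.1 (this 0 (Finset.mem_univ _))

lemma ae_ne_zero_stdPi [Nonempty ι] : ∀ᵐ a ∂(stdPi ι), a ≠ 0 := by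
  obtain ⟨i⟩ := ‹Nonempty ι›
  rw [ae_iff]
  refine measure_mono_null (fun a ha => ?_) (stdPi_eval_eq i 0)
  simp only [ne_eq, not_not, Set.mem_ofPred_eq] at ha
  simp [ha]

/-- Fubini: for almost every first vector, namely every nonzero one, the section is null. This set
will contain the boundary of the event in the portmanteau argument. -/
lemma prod_stdPi_degenerate {m : ℕ} (hm : m ≠ 0) {r : ℝ} (hr : 0 ≤ r) (t : ℝ) :
    ((stdPi (Fin (m + 1))).prod (stdPi (Fin (m + 1))))
      ({x | (x.1 ⬝ᵥ x.1) * (x.2 ⬝ᵥ x.2) - (x.1 ⬝ᵥ x.2) ^ 2 = 0} ∪ {x | tStat m r x.1 x.2 = t})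
      = 0 := by
  have hm1 : MeasurableSet {x : (Fin (m + 1) → ℝ) × (Fin (m + 1) → ℝ) |
      (x.1 ⬝ᵥ x.1) * (x.2 ⬝ᵥ x.2) - (x.1 ⬝ᵥ x.2) ^ 2 = 0} := by
    unfold dotProduct
    exact measurableSet_eq_fun (by fun_prop) (by fun_prop)
  have hm2 : MeasurableSet {x : (Fin (m + 1) → ℝ) × (Fin (m + 1) → ℝ) |
      tStat m r x.1 x.2 = t} :=
    measurableSet_eq_fun (measurable_tStat m r) measurable_const
  rw [Measure.measure_prod_null (hm1.union hm2)]
  filter_upwards [ae_ne_zero_stdPi] with a ha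
  refine measure_union_null ((map_tStat hr ha).2 hm) ?_
  have h := noncentralT_singleton hm (√(r ^ 2 * ∑ i, a i ^ 2)) t
  rwa [← (map_tStat hr ha).1, Measure.map_apply
    (measurable_tStat_right m r a) (measurableSet_singleton t)] at h

lemma measurable_noncentralT_Iic (m : ℕ) (t : ℝ) :
    Measurable fun w => (noncentralT m w).real (Set.Iic t) := by
  have h := measurable_measure_prodMk_left (ν := (gaussianReal 0 1).prod (chiSq m))
    (measurable_noncentral m (measurableSet_Iic (a := t)))
  convert! h.ennreal_toReal using 2 with w
  rw [measureReal_def, noncentralT, Measure.map_apply (by fun_prop) measurableSet_Iic]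
  rfl

/-- Integrate out the second vector with the first one, a, fixed: the noncentrality is then the
square root of φ²/(1-φ²) |a|², which has law `lawW` because |a|² is chi-square with m + 1 degrees of
freedom. -/
theorem prod_stdPi_tStat_le (m : ℕ) {φ : ℝ} (hφ : 0 ≤ φ) (hφ1 : φ < 1) (t : ℝ) :
    ((stdPi (Fin (m + 1))).prod (stdPi (Fin (m + 1)))).real
      {x | tStat m (φ / √(1 - φ ^ 2)) x.1 x.2 ≤ t}
      = ∫ w, (noncentralT m w).real (Set.Iic t) ∂(lawW φ (m + 1)) := by
  have hmeas : MeasurableSet {x : (Fin (m + 1) → ℝ) × (Fin (m + 1) → ℝ) |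
      tStat m (φ / √(1 - φ ^ 2)) x.1 x.2 ≤ t} := measurable_tStat m _ measurableSet_Iic
  have hr : 0 ≤ φ / √(1 - φ ^ 2) := by positivity
  have hr2 : (φ / √(1 - φ ^ 2)) ^ 2 = φ ^ 2 / (1 - φ ^ 2) := by
    rw [div_pow, Real.sq_sqrt (by nlinarith)]
  rw [lawW, chiSq, Measure.map_map (by fun_prop) measurable_sum_sq,
    integral_map (Measurable.aemeasurable (by fun_prop))
      (measurable_noncentralT_Iic m t).aestronglyMeasurable,
    measureReal_def, Measure.prod_apply hmeas,
    ← integral_toReal (measurable_measure_prodMk_left hmeas).aemeasurable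
      (.of_forall fun _ => measure_lt_top _ _)]
  refine integral_congr_ae ?_
  filter_upwards [ae_ne_zero_stdPi] with a ha
  rw [Function.comp_apply, ← hr2, ← (map_tStat hr ha).1, measureReal_def, Measure.map_apply
    (measurable_tStat_right m _ a) measurableSet_Iic]
  rfl

end Gaussian

/-! ### Second moments under convergence in distribution. -/

lemma integral_add_mul_sq {α : Type*} [MeasurableSpace α] {μ : Measure α} {F G : α → ℝ}
    (hF : MemLp F 2 μ) (hG : MemLp G 2 μ) (c : ℝ) : ∫ x, (F x + c * G x) ^ 2 ∂μ
      = ∫ x, F x ^ 2 ∂μ + 2 * c * ∫ x, F x * G x ∂μ + c ^ 2 * ∫ x, G x ^ 2 ∂μ := by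
  have hFG : Integrable (fun x => 2 * c * (F x * G x)) μ := (hF.integrable_mul hG).const_mul _
  have hGG : Integrable (fun x => c ^ 2 * G x ^ 2) μ := hG.integrable_sq.const_mul _
  have hF2 : Integrable (fun x => F x ^ 2) μ := hF.integrable_sq
  have hsum : Integrable (fun x => F x ^ 2 + 2 * c * (F x * G x)) μ := hF2.add hFG
  rw [← integral_const_mul, ← integral_const_mul, ← integral_add hF2 hFG,
    ← integral_add hsum hGG]
  congr 1
  ext x
  ring

section LimitMoments

variable {E : Type*} [TopologicalSpace E] [MeasurableSpace E] [BorelSpace E]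
  [HasOuterApproxClosed E] {Ω : ℕ × ℕ → Type*} [∀ d, MeasurableSpace (Ω d)]
  {P : ∀ d, Measure (Ω d)} [∀ d, IsProbabilityMeasure (P d)]
  {γ : Measure E} [IsProbabilityMeasure γ] {X : ∀ d, Ω d → E} {f g : E → ℝ} {v w : ℝ}

/-- Fatou's lemma for convergence in distribution. -/
lemma integral_le_of_tendstoInDistribution
    (hX : TendstoInDistribution X atTop (fun z => z) P γ) (hf : Continuous f) (hf0 : 0 ≤ f)
    (hfX : ∀ d, Integrable (fun ω => f (X d ω)) (P d))
    (hlim : Tendsto (fun d => ∫ ω, f (X d ω) ∂(P d)) atTop (𝓝 v)) :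
    ∫ z, f z ∂γ ≤ v := by
  have hv : 0 ≤ v := ge_of_tendsto' hlim fun d => integral_nonneg fun ω => hf0 _
  -- The diagonal d = (i, i) turns the net into a sequence; the limit `v` of the integrals is
  -- unchanged along it.
  have hdiag := tendsto_atTop_diagonal (α := ℕ)
  have h1 := lintegral_le_liminf_lintegral_of_forall_isOpen_measure_le_liminf_measure
    (μ := γ.map fun z => z) (μs := fun i => (P (i, i)).map (X (i, i))) hf hf0
    fun G hG => ProbabilityMeasure.le_liminf_measure_open_of_tendsto (hX.tendsto.comp hdiag) hG
  have h2 (i : ℕ) : ∫⁻ z, ENNReal.ofReal (f z) ∂((P (i, i)).map (X (i, i)))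
      = ENNReal.ofReal (∫ ω, f (X (i, i) ω) ∂(P (i, i))) := by
    rw [lintegral_map' (by fun_prop) (hX.forall_aemeasurable _),
      ofReal_integral_eq_lintegral_ofReal (hfX _) (.of_forall fun ω => hf0 _)]
  simp only [h2] at h1
  have h3 : Tendsto (fun i : ℕ => ENNReal.ofReal (∫ ω, f (X (i, i) ω) ∂(P (i, i)))) atTop
      (𝓝 (ENNReal.ofReal v)) := ENNReal.tendsto_ofReal (hlim.comp hdiag)
  rw [h3.liminf_eq, Measure.map_id'] at h1
  rw [integral_eq_lintegral_of_nonneg_ae (.of_forall hf0) hf.aestronglyMeasurable]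
  exact ENNReal.toReal_le_of_le_ofReal hv h1

/-- If second moments converge to the variance of the limit, the limit is centered. -/
lemma integral_limit_eq_zero
    (hX : TendstoInDistribution X atTop (fun z => z) P γ) (hf : Continuous f)
    (hfγ : MemLp f 2 γ) (hfX : ∀ d, MemLp (fun ω => f (X d ω)) 2 (P d))
    (hlim : Tendsto (fun d => ∫ ω, f (X d ω) ^ 2 ∂(P d)) atTop (𝓝 Var[f; γ])) :
    ∫ z, f z ∂γ = 0 := by
  -- Fatou gives E f² ≤ Var f = E f² - (E f)², so E f = 0.
  have h := integral_le_of_tendstoInDistribution (f := fun z => f z ^ 2) hX (hf.pow 2)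
    (fun z => sq_nonneg _) (fun d => (hfX d).integrable_sq) hlim
  have hvar := variance_eq_sub hfγ
  simp only [Pi.pow_apply] at hvar
  nlinarith

/-- If second moments converge to the variances of the limit, uncorrelated variables remain
uncorrelated in the limit. -/
lemma covariance_limit_eq_zero
    (hX : TendstoInDistribution X atTop (fun z => z) P γ) (hf : Continuous f) (hg : Continuous g)
    (hfγ : MemLp f 2 γ) (hgγ : MemLp g 2 γ) (hfX : ∀ d, MemLp (fun ω => f (X d ω)) 2 (P d))
    (hgX : ∀ d, MemLp (fun ω => g (X d ω)) 2 (P d))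
    (hflim : Tendsto (fun d => ∫ ω, f (X d ω) ^ 2 ∂(P d)) atTop (𝓝 Var[f; γ]))
    (hglim : Tendsto (fun d => ∫ ω, g (X d ω) ^ 2 ∂(P d)) atTop (𝓝 Var[g; γ]))
    (hfg : ∀ d, ∫ ω, f (X d ω) * g (X d ω) ∂(P d) = 0) :
    cov[f, g; γ] = 0 := by
  have hf0 := integral_limit_eq_zero hX hf hfγ hfX hflim
  have hg0 := integral_limit_eq_zero hX hg hgγ hgX hglim
  have hvf := variance_eq_sub hfγ
  have hvg := variance_eq_sub hgγ
  rw [hf0] at hvf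
  rw [hg0] at hvg
  -- The cross term vanishes before the limit, so Fatou bounds E (f + c g)² by E f² + c² E g².
  -- Taking c = 1 and c = -1 turns the one-sided bound into an equality.
  have key (c : ℝ) : 2 * c * ∫ z, f z * g z ∂γ ≤ 0 := by
    have h := integral_le_of_tendstoInDistribution (f := fun z => (f z + c * g z) ^ 2)
      (v := Var[f; γ] + c ^ 2 * Var[g; γ]) hX (by fun_prop) (fun z => sq_nonneg _)
      (fun d => ((hfX d).add ((hgX d).const_mul c)).integrable_sq) (by
        refine (hflim.add (hglim.const_mul (c ^ 2))).congr fun d => ?_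
        rw [integral_add_mul_sq (hfX d) (hgX d), hfg]
        ring)
    rw [integral_add_mul_sq hfγ hgγ, hvf, hvg] at h
    simp only [Pi.pow_apply] at h
    linarith
  rw [covariance_eq_sub hfγ hgγ, hf0, zero_mul, sub_zero]
  simp only [Pi.mul_apply]
  linarith [key 1, key (-1)]

end LimitMoments

/-! ### Standardizing the Gaussian limit. -/

section LimitLaw

open Matrix

variable {ι κ : Type*} [Fintype ι]

/-- Standardization of two jointly Gaussian vectors with correlation `φ` between corresponding
coordinates. -/
noncomputable def standardize (U : Matrix κ ι ℝ) (σx σy φ : ℝ)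
    (z : (ι → ℝ) × (ι → ℝ)) : (κ → ℝ) × (κ → ℝ) :=
  (fun i => σx⁻¹ * (U *ᵥ z.1) i,
    fun i => (√(1 - φ ^ 2))⁻¹ * (σy⁻¹ * (U *ᵥ z.2) i - φ * (σx⁻¹ * (U *ᵥ z.1) i)))

/-- The second block is the residual of regressing y on x; its variance before scaling is 1 - 2φ² +
φ² = 1 - φ². It is uncorrelated with the first block, hence independent of it by joint Gaussianity.
-/
lemma map_standardize [Fintype κ] [DecidableEq ι] [DecidableEq κ]
    {γ : Measure ((ι → ℝ) × (ι → ℝ))} [IsGaussian γ] {U : Matrix κ ι ℝ}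
    (hU : U * Uᵀ = 1) {σx σy φ : ℝ} (hσx : 0 < σx) (hσy : 0 < σy) (hφ0 : 0 ≤ φ) (hφ1 : φ < 1)
    (hm1 : ∀ e, ∫ z, z.1 e ∂γ = 0) (hm2 : ∀ e, ∫ z, z.2 e ∂γ = 0)
    (h11 : ∀ e f, cov[fun z => z.1 e, fun z => z.1 f; γ] = σx ^ 2 * (1 : Matrix ι ι ℝ) e f)
    (h22 : ∀ e f, cov[fun z => z.2 e, fun z => z.2 f; γ] = σy ^ 2 * (1 : Matrix ι ι ℝ) e f)
    (h12 : ∀ e f, cov[fun z => z.1 e, fun z => z.2 f; γ]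
      = (φ * (σx * σy)) * (1 : Matrix ι ι ℝ) e f) :
    γ.map (standardize U σx σy φ) = (stdPi κ).prod (stdPi κ) := by
  set s := √(1 - φ ^ 2) with hs
  have hs0 : 0 < 1 - φ ^ 2 := by nlinarith
  have hspos : 0 < s := Real.sqrt_pos.2 hs0
  have hs2 : s ^ 2 = 1 - φ ^ 2 := Real.sq_sqrt hs0.le
  have hid : HasGaussianLaw (fun z : (ι → ℝ) × (ι → ℝ) => z) γ := IsGaussian.hasGaussianLaw_id
  let L : ((ι → ℝ) × (ι → ℝ)) →ₗ[ℝ] (κ → ℝ) × (κ → ℝ) :=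
    { toFun := standardize U σx σy φ
      map_add' := fun x y => by
        ext i <;> simp only [standardize, Prod.fst_add, Prod.snd_add, mulVec_add, Pi.add_apply] <;>
          ring
      map_smul' := fun c x => by
        ext i <;> simp only [standardize, Prod.smul_fst, Prod.smul_snd, mulVec_smul, Pi.smul_apply,
          smul_eq_mul, RingHom.id_apply] <;> ring }
  have hL : HasGaussianLaw (fun z => ((standardize U σx σy φ z).1, (standardize U σx σy φ z).2)) γ :=
    hid.map_fun (LinearMap.toContinuousLinearMap L)
  have hU1 (i : κ) : HasGaussianLaw (fun z : (ι → ℝ) × (ι → ℝ) => (U *ᵥ z.1) i) γ :=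
    (hid.fst.map_fun (LinearMap.toContinuousLinearMap U.mulVecLin)).eval i
  have hU2 (i : κ) : HasGaussianLaw (fun z : (ι → ℝ) × (ι → ℝ) => (U *ᵥ z.2) i) γ :=
    (hid.snd.map_fun (LinearMap.toContinuousLinearMap U.mulVecLin)).eval i
  have M1 (i : κ) (c : ℝ) := (hU1 i).memLp_two.const_mul c
  have M2 (i : κ) (c : ℝ) := (hU2 i).memLp_two.const_mul c
  have c11 (i j : κ) : cov[fun z => (U *ᵥ z.1) i, fun z => (U *ᵥ z.1) j; γ]
      = σx ^ 2 * (1 : Matrix κ κ ℝ) i j := by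
    rw [covariance_mulVec (X := Prod.fst) (Y := Prod.fst)
      (fun e => (hid.fst.eval e).memLp_two) (fun e => (hid.fst.eval e).memLp_two) h11, hU]
  have c22 (i j : κ) : cov[fun z => (U *ᵥ z.2) i, fun z => (U *ᵥ z.2) j; γ]
      = σy ^ 2 * (1 : Matrix κ κ ℝ) i j := by
    rw [covariance_mulVec (X := Prod.snd) (Y := Prod.snd)
      (fun e => (hid.snd.eval e).memLp_two) (fun e => (hid.snd.eval e).memLp_two) h22, hU]
  have c12 (i j : κ) : cov[fun z => (U *ᵥ z.1) i, fun z => (U *ᵥ z.2) j; γ]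
      = φ * (σx * σy) * (1 : Matrix κ κ ℝ) i j := by
    rw [covariance_mulVec (X := Prod.fst) (Y := Prod.snd)
      (fun e => (hid.fst.eval e).memLp_two) (fun e => (hid.snd.eval e).memLp_two) h12, hU]
  have c21 (i j : κ) : cov[fun z => (U *ᵥ z.2) i, fun z => (U *ᵥ z.1) j; γ]
      = φ * (σx * σy) * (1 : Matrix κ κ ℝ) i j := by
    rw [covariance_comm, c12, ← Matrix.transpose_apply 1, Matrix.transpose_one]
  have m1 (i : κ) : ∫ z, (U *ᵥ z.1) i ∂γ = 0 := by
    simp only [mulVec, dotProduct]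
    rw [integral_finsetSum _ fun e _ => ((hid.fst.eval e).integrable.const_mul _)]
    simp [integral_const_mul, hm1]
  have m2 (i : κ) : ∫ z, (U *ᵥ z.2) i ∂γ = 0 := by
    simp only [mulVec, dotProduct]
    rw [integral_finsetSum _ fun e _ => ((hid.snd.eval e).integrable.const_mul _)]
    simp [integral_const_mul, hm2]
  have d11 (i j : κ) : cov[fun z => (standardize U σx σy φ z).1 i,
      fun z => (standardize U σx σy φ z).1 j; γ] = (1 : Matrix κ κ ℝ) i j := by
    simp only [standardize]
    rw [covariance_const_mul_left, covariance_const_mul_right, c11]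
    field_simp
  have d12 (i j : κ) : cov[fun z => (standardize U σx σy φ z).1 i,
      fun z => (standardize U σx σy φ z).2 j; γ] = 0 := by
    simp only [standardize]
    rw [covariance_const_mul_left, covariance_const_mul_right,
      covariance_fun_sub_right (hU1 i).memLp_two (M2 j _) ((M1 j _).const_mul _)]
    simp only [covariance_const_mul_right, c11, c12]
    field_simp
    ring
  have d22 (i j : κ) : cov[fun z => (standardize U σx σy φ z).2 i,
      fun z => (standardize U σx σy φ z).2 j; γ] = (1 : Matrix κ κ ℝ) i j := by
    simp only [standardize]
    rw [covariance_const_mul_left, covariance_const_mul_right,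
      covariance_fun_sub_fun_sub (M2 i _) ((M1 i _).const_mul _) (M2 j _) ((M1 j _).const_mul _)]
    simp only [covariance_const_mul_left, covariance_const_mul_right, c11, c12, c21, c22]
    rw [← hs]
    field_simp
    rw [hs2]
    ring
  have l1 : γ.map (fun z => (standardize U σx σy φ z).1) = stdPi κ := by
    refine map_eq_stdPi_of_covariance hL.fst (fun i => ?_) (fun i => ?_) (fun i j hij => ?_)
    · simp only [standardize, integral_const_mul, m1, mul_zero]
    · rw [← covariance_self (hL.fst.eval i).aemeasurable, d11, one_apply_eq]
    · rw [d11, one_apply_ne hij]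
  have l2 : γ.map (fun z => (standardize U σx σy φ z).2) = stdPi κ := by
    refine map_eq_stdPi_of_covariance hL.snd (fun i => ?_) (fun i => ?_) (fun i j hij => ?_)
    · simp only [standardize, integral_const_mul]
      rw [integral_sub ((hU2 i).integrable.const_mul _)
        (((hU1 i).integrable.const_mul _).const_mul _)]
      simp only [integral_const_mul, m1, m2, mul_zero, sub_zero]
    · rw [← covariance_self (hL.snd.eval i).aemeasurable, d22, one_apply_eq]
    · rw [d22, one_apply_ne hij]
  have hind := HasGaussianLaw.indepFun_of_covariance_eval
    (X := fun i z => (standardize U σx σy φ z).1 i)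
    (Y := fun i z => (standardize U σx σy φ z).2 i) hL d12
  have h := (indepFun_iff_map_prod_eq_prod_map_map hL.fst.aemeasurable hL.snd.aemeasurable).1 hind
  rw [l1, l2] at h
  exact h

/-- The studentized correlation of two vectors. -/
noncomputable def corStat [Fintype κ] (m : ℕ) (a b : κ → ℝ) : ℝ :=
  √m * ((a ⬝ᵥ b) / √((a ⬝ᵥ a) * (b ⬝ᵥ b) - (a ⬝ᵥ b) ^ 2))

/-- Adding a multiple of `a` to the second vector does not change the Gram determinant, so only the
scalings enter; σx σy s then cancels between numerator and denominator. -/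
lemma corStat_smul_eq_tStat [Fintype κ] (m : ℕ) {σx σy φ s : ℝ} (hσx : 0 < σx)
    (hσy : 0 < σy) (hs : 0 < s) (a b : κ → ℝ) :
    corStat m (σx • a) (σy • (φ • a + s • b)) = tStat m (φ / s) a b := by
  have hgram : ((σx • a) ⬝ᵥ (σx • a))
        * ((σy • (φ • a + s • b)) ⬝ᵥ (σy • (φ • a + s • b)))
        - ((σx • a) ⬝ᵥ (σy • (φ • a + s • b))) ^ 2
      = (σx * σy * s) ^ 2 * ((a ⬝ᵥ a) * (b ⬝ᵥ b) - (a ⬝ᵥ b) ^ 2) := by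
    simp only [smul_dotProduct, dotProduct_smul, add_dotProduct, dotProduct_add, smul_eq_mul,
      dotProduct_comm b a]
    ring
  have hnum : (σx • a) ⬝ᵥ (σy • (φ • a + s • b))
      = (σx * σy * s) * (φ / s * (a ⬝ᵥ a) + a ⬝ᵥ b) := by
    simp only [smul_dotProduct, dotProduct_smul, dotProduct_add, smul_eq_mul]
    field_simp
  rw [corStat, tStat, hgram, hnum, Real.sqrt_mul (sq_nonneg _), Real.sqrt_sq (by positivity),
    mul_div_mul_left _ _ (by positivity)]

lemma eq_of_standardize (U : Matrix κ ι ℝ) {σx σy φ : ℝ} (hσx : 0 < σx) (hσy : 0 < σy)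
    (hφ0 : 0 ≤ φ) (hφ1 : φ < 1) (z : (ι → ℝ) × (ι → ℝ)) :
    U *ᵥ z.1 = σx • (standardize U σx σy φ z).1 ∧
    U *ᵥ z.2 = σy • (φ • (standardize U σx σy φ z).1
      + √(1 - φ ^ 2) • (standardize U σx σy φ z).2) := by
  have hs : 0 < √(1 - φ ^ 2) := Real.sqrt_pos.2 (by nlinarith)
  constructor
  · ext i
    simp only [standardize, Pi.smul_apply, smul_eq_mul]
    field_simp
  · ext i
    simp only [standardize, Pi.smul_apply, smul_eq_mul, Pi.add_apply]
    rw [mul_inv_cancel_left₀ hs.ne', add_sub_cancel, mul_inv_cancel_left₀ hσy.ne']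

lemma corStat_eq_tStat [Fintype κ] (m : ℕ) (U : Matrix κ ι ℝ) {σx σy φ : ℝ} (hσx : 0 < σx) (hσy : 0 < σy)
    (hφ0 : 0 ≤ φ) (hφ1 : φ < 1) (z : (ι → ℝ) × (ι → ℝ)) :
    corStat m (U *ᵥ z.1) (U *ᵥ z.2) = tStat m (φ / √(1 - φ ^ 2))
      (standardize U σx σy φ z).1 (standardize U σx σy φ z).2 := by
  obtain ⟨h1, h2⟩ := eq_of_standardize U hσx hσy hφ0 hφ1 z
  rw [h1, h2, corStat_smul_eq_tStat m hσx hσy (Real.sqrt_pos.2 (by nlinarith))]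

end LimitLaw

/-! ### Double-centered kernels and their orthogonality. -/

lemma integral_sub_sub_add_const {α : Type*} [MeasurableSpace α] {μ : Measure α}
    [IsProbabilityMeasure μ] {f g h : α → ℝ} (hf : Integrable f μ) (hg : Integrable g μ)
    (hh : Integrable h μ) (c : ℝ) :
    ∫ x, (f x - g x - h x + c) ∂μ = ∫ x, f x ∂μ - ∫ x, g x ∂μ - ∫ x, h x ∂μ + c := by
  have h1 : Integrable (fun x => f x - g x) μ := hf.sub hg
  have h2 : Integrable (fun x => f x - g x - h x) μ := h1.sub hh
  rw [integral_add h2 (integrable_const _), integral_sub h1 hh, integral_sub hf hg]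
  simp

lemma kernelDist_comm {Ω : Type*} [MeasurableSpace Ω] {P : Measure Ω} {k : ℝ → ℝ → ℝ} {n : ℕ}
    (hk : ∀ x y, k x y = k y x) (x : Fin n → Ω → ℝ) (s t : Fin n) (ω : Ω) :
    kernelDist P k x s t ω = kernelDist P k x t s ω := by
  simp only [kernelDist, eq_comm (a := s) (b := t), hk (x s _) (x t _)]
  split_ifs <;> ring

lemma integrable_kernel_prod {Ω : Type*} [MeasurableSpace Ω] {P : Measure Ω}
    [IsProbabilityMeasure P] {μ : Measure ℝ} {k : ℝ → ℝ → ℝ} {x y : Ω → ℝ} (hx : Measurable x) (hy : Measurable y)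
    (hxμ : P.map x = μ) (hyμ : P.map y = μ) (hxy : IndepFun x y P)
    (hk : Measurable (Function.uncurry k)) (hint : Integrable (fun ω => k (x ω) (y ω)) P) :
    Integrable (Function.uncurry k) (μ.prod μ) := by
  have h := (indepFun_iff_map_prod_eq_prod_map_map hx.aemeasurable hy.aemeasurable).1 hxy
  rw [hxμ, hyμ] at h
  rw [← h, integrable_map_measure hk.aestronglyMeasurable (hx.prodMk hy).aemeasurable]
  exact hint

section DoubleCenter

variable {Ω : Type*} [MeasurableSpace Ω] {P : Measure Ω} [IsProbabilityMeasure P]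
  {μ : Measure ℝ} [IsProbabilityMeasure μ] {k l : ℝ → ℝ → ℝ} {n : ℕ}

/-- By independence the conditional distribution of `y` given `x` is the constant kernel equal to
the law of `y`. -/
lemma condExp_kernel_of_indepFun {x y : Ω → ℝ} (hx : Measurable x) (hy : Measurable y)
    (hxy : IndepFun x y P) (hk : Measurable (Function.uncurry k))
    (hint : Integrable (fun ω => k (x ω) (y ω)) P) :
    P[fun ω => k (x ω) (y ω) | MeasurableSpace.comap x inferInstance]
      =ᵐ[P] fun ω => ∫ v, k (x ω) v ∂(P.map y) := by
  have h1 := condExp_prod_ae_eq_integral_condDistrib (f := Function.uncurry k) hx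
    hy.aemeasurable hk.stronglyMeasurable hint
  have : IsProbabilityMeasure (P.map y) := Measure.isProbabilityMeasure_map hy.aemeasurable
  have h2 : condDistrib y x P =ᵐ[P.map x] Kernel.const ℝ (P.map y) := by
    refine condDistrib_ae_eq_of_measure_eq_compProd x hy.aemeasurable ?_
    rw [Measure.compProd_const]
    exact (indepFun_iff_map_prod_eq_prod_map_map hx.aemeasurable hy.aemeasurable).1 hxy
  refine h1.trans ?_
  filter_upwards [ae_of_ae_map hx.aemeasurable h2] with ω hω
  rw [hω]
  rfl

/-- The double centered version of a symmetric kernel. -/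
noncomputable def doubleCenter (μ : Measure ℝ) (k : ℝ → ℝ → ℝ) (x y : ℝ) : ℝ :=
  k x y - ∫ v, k x v ∂μ - ∫ v, k y v ∂μ + ∫ u, ∫ v, k u v ∂μ ∂μ

lemma measurable_doubleCenter (hk : Measurable (Function.uncurry k)) :
    Measurable (Function.uncurry (doubleCenter μ k)) := by
  have h : Measurable fun x => ∫ v, k x v ∂μ :=
    (hk.stronglyMeasurable.integral_prod_right (ν := μ)).measurable
  exact ((hk.sub (h.comp measurable_fst)).sub (h.comp measurable_snd)).add_const _

/-- This replaces the conditional expectations by a deterministic function of the two sample points,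
so that Fubini can be applied to products. -/
lemma kernelDist_ae_eq {x : Fin n → Ω → ℝ} {s t : Fin n} (hst : s ≠ t)
    (hs : Measurable (x s)) (ht : Measurable (x t)) (hsμ : P.map (x s) = μ)
    (htμ : P.map (x t) = μ) (hind : IndepFun (x s) (x t) P)
    (hk : Measurable (Function.uncurry k)) (hsymm : ∀ x y, k x y = k y x)
    (hint : Integrable (fun ω => k (x s ω) (x t ω)) P) :
    kernelDist P k x s t =ᵐ[P] fun ω => doubleCenter μ k (x s ω) (x t ω) := by
  have h1 := condExp_kernel_of_indepFun hs ht hind hk hint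
  have h2 := condExp_kernel_of_indepFun ht hs hind.symm hk
    (hint.congr (.of_forall fun ω => hsymm _ _))
  have h3 : ∫ ω, k (x s ω) (x t ω) ∂P = ∫ u, ∫ v, k u v ∂μ ∂μ := by
    have h := (indepFun_iff_map_prod_eq_prod_map_map hs.aemeasurable ht.aemeasurable).1 hind
    rw [hsμ, htμ] at h
    have hprod := integral_prod _ (integrable_kernel_prod hs ht hsμ htμ hind hk hint)
    rw [← h, integral_map (hs.prodMk ht).aemeasurable hk.aestronglyMeasurable] at hprod
    exact hprod
  simp only [hsymm (x t _) (x s _)] at h2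
  rw [htμ] at h1
  rw [hsμ] at h2
  filter_upwards [h1, h2] with ω hω1 hω2
  rw [kernelDist, if_neg hst, hω1, hω2, h3, doubleCenter]

lemma integral_doubleCenter (hsymm : ∀ x y, k x y = k y x)
    (hint : Integrable (Function.uncurry k) (μ.prod μ)) :
    ∀ᵐ y ∂μ, ∫ u, doubleCenter μ k u y ∂μ = 0 := by
  have hg : Integrable (fun x => ∫ v, k x v ∂μ) μ := hint.integral_prod_left
  filter_upwards [hint.prod_left_ae] with y hy
  have hy' : Integrable (fun u => k u y) μ := hy
  simp only [doubleCenter]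
  rw [integral_sub_sub_add_const hy' hg (integrable_const _)]
  simp [hsymm y]

lemma integral_eq_zero_of_indepFun {α β : Type*} [MeasurableSpace α] [MeasurableSpace β]
    {U : Ω → α} {V : Ω → β} (hU : Measurable U) (hV : Measurable V) (hUV : IndepFun U V P)
    {G : α × β → ℝ} (hG : Measurable G)
    (h0 : ∀ᵐ v ∂(P.map V), ∫ u, G (u, v) ∂(P.map U) = 0) :
    ∫ ω, G (U ω, V ω) ∂P = 0 := by
  have h := (indepFun_iff_map_prod_eq_prod_map_map hU.aemeasurable hV.aemeasurable).1 hUV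
  rw [← integral_map (f := G) (hU.prodMk hV).aemeasurable hG.aestronglyMeasurable, h]
  have : IsProbabilityMeasure (P.map U) := Measure.isProbabilityMeasure_map hU.aemeasurable
  have : IsProbabilityMeasure (P.map V) := Measure.isProbabilityMeasure_map hV.aemeasurable
  -- No integrability is assumed: the Bochner integral of a nonintegrable function is 0 anyway.
  by_cases hi : Integrable G ((P.map U).prod (P.map V))
  · rw [integral_prod_symm _ hi, integral_congr_ae h0, integral_zero]
  · exact integral_undef hi

lemma integral_kernelDist {x : Fin n → Ω → ℝ} {s t : Fin n}
    (hs : Measurable (x s)) (ht : Measurable (x t))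
    (hint : Integrable (fun ω => k (x s ω) (x t ω)) P) :
    ∫ ω, kernelDist P k x s t ω ∂P = 0 := by
  by_cases hst : s = t
  · simp [kernelDist, hst]
  simp only [kernelDist, if_neg hst]
  rw [integral_sub_sub_add_const hint integrable_condExp integrable_condExp,
    integral_condExp hs.comap_le, integral_condExp ht.comap_le]
  simp

variable {α : Type*} [MeasurableSpace α] {Z : Fin n → Ω → α} {ν : Measure α} {f g : α → ℝ}

/-- The point `s` enters only the first factor. With all other points fixed, integrating over it
gives 0 by double centering. -/
lemma integral_kernelDist_mul_of_ne (hZ : ∀ s, Measurable (Z s)) (hind : iIndepFun Z P)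
    (hν : ∀ s, P.map (Z s) = ν) (hf : Measurable f) (hg : Measurable g)
    (hk : Measurable (Function.uncurry k)) (hl : Measurable (Function.uncurry l))
    (hk_symm : ∀ x y, k x y = k y x) (hl_symm : ∀ x y, l x y = l y x)
    (hkint : ∀ s t, s ≠ t → Integrable (fun ω => k (f (Z s ω)) (f (Z t ω))) P)
    (hlint : ∀ s t, s ≠ t → Integrable (fun ω => l (g (Z s ω)) (g (Z t ω))) P)
    {s t a b : Fin n} (hst : s ≠ t) (hab : a ≠ b) (hsa : s ≠ a) (hsb : s ≠ b) :
    ∫ ω, kernelDist P k (fun r ω => f (Z r ω)) s t ω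
      * kernelDist P l (fun r ω => g (Z r ω)) a b ω ∂P = 0 := by
  have hνP : IsProbabilityMeasure ν := hν s ▸ Measure.isProbabilityMeasure_map (hZ s).aemeasurable
  have : IsProbabilityMeasure (ν.map f) := Measure.isProbabilityMeasure_map hf.aemeasurable
  have : IsProbabilityMeasure (ν.map g) := Measure.isProbabilityMeasure_map hg.aemeasurable
  have hfm (r) : Measurable fun ω => f (Z r ω) := hf.comp (hZ r)
  have hgm (r) : Measurable fun ω => g (Z r ω) := hg.comp (hZ r)
  have hfν (r) : P.map (fun ω => f (Z r ω)) = ν.map f := by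
    rw [← hν r, Measure.map_map hf (hZ r)]; rfl
  have hgν (r) : P.map (fun ω => g (Z r ω)) = ν.map g := by
    rw [← hν r, Measure.map_map hg (hZ r)]; rfl
  have h1 := kernelDist_ae_eq (x := fun r ω => f (Z r ω)) hst (hfm s) (hfm t) (hfν s) (hfν t)
    ((hind.indepFun hst).comp hf hf) hk hk_symm (hkint s t hst)
  have h2 := kernelDist_ae_eq (x := fun r ω => g (Z r ω)) hab (hgm a) (hgm b) (hgν a) (hgν b)
    ((hind.indepFun hab).comp hg hg) hl hl_symm (hlint a b hab)
  refine (integral_congr_ae (h1.mul h2)).trans ?_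
  -- All points except `s` are taken as one block, which avoids distinguishing whether `t` coincides
  -- with `a` or `b`.
  let T : Finset (Fin n) := Finset.univ.erase s
  have htT : t ∈ T := by simp [T, hst.symm]
  have haT : a ∈ T := by simp [T, hsa.symm]
  have hbT : b ∈ T := by simp [T, hsb.symm]
  have hUV : IndepFun (Z s) (fun ω (i : T) => Z i ω) P :=
    (hind.indepFun_finset {s} T (by simp [T]) hZ).comp
      (φ := fun z : ({s} : Finset (Fin n)) → α => z ⟨s, by simp⟩) (ψ := id)
      (measurable_pi_apply _) measurable_id
  have hVm : Measurable fun ω (i : T) => Z i ω := measurable_pi_lambda _ fun i => hZ i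
  have hmk := measurable_doubleCenter (μ := ν.map f) hk
  have hml := measurable_doubleCenter (μ := ν.map g) hl
  refine integral_eq_zero_of_indepFun (hZ s) hVm hUV
    (G := fun w => doubleCenter (ν.map f) k (f w.1) (f (w.2 ⟨t, htT⟩))
      * doubleCenter (ν.map g) l (g (w.2 ⟨a, haT⟩)) (g (w.2 ⟨b, hbT⟩)))
    ((hmk.comp ((hf.comp measurable_fst).prodMk
        (hf.comp ((measurable_pi_apply _).comp measurable_snd)))).mul
      (hml.comp ((hg.comp ((measurable_pi_apply _).comp measurable_snd)).prodMk
        (hg.comp ((measurable_pi_apply _).comp measurable_snd))))) ?_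
  have h3 := integral_doubleCenter hk_symm (integrable_kernel_prod (hfm s) (hfm t) (hfν s) (hfν t)
    ((hind.indepFun hst).comp hf hf) hk (hkint s t hst))
  have h4 : Measurable fun v : T → α => f (v ⟨t, htT⟩) := hf.comp (measurable_pi_apply _)
  have h5 : (P.map fun ω (i : T) => Z i ω).map (fun v : T → α => f (v ⟨t, htT⟩)) = ν.map f := by
    rw [Measure.map_map h4 hVm]
    exact hfν t
  rw [← h5] at h3
  filter_upwards [ae_of_ae_map h4.aemeasurable h3] with v hv
  rw [integral_mul_const, hν s]
  have hm1 : Measurable fun x => doubleCenter (ν.map f) k x (f (v ⟨t, htT⟩)) :=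
    hmk.comp (measurable_id.prodMk measurable_const)
  rw [h5, integral_map hf.aemeasurable hm1.aestronglyMeasurable] at hv
  rw [hv, zero_mul]

/-- With the point `t` fixed, the two factors are functions of the independent `f` and `g` at the
point `s`; the integral factorizes, and the first factor has mean 0. -/
lemma integral_kernelDist_mul_of_indepFun (hZ : ∀ s, Measurable (Z s)) (hind : iIndepFun Z P)
    (hν : ∀ s, P.map (Z s) = ν) (hf : Measurable f) (hg : Measurable g)
    (hfg : IndepFun f g ν)
    (hk : Measurable (Function.uncurry k)) (hl : Measurable (Function.uncurry l))
    (hk_symm : ∀ x y, k x y = k y x) (hl_symm : ∀ x y, l x y = l y x)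
    (hkint : ∀ s t, s ≠ t → Integrable (fun ω => k (f (Z s ω)) (f (Z t ω))) P)
    (hlint : ∀ s t, s ≠ t → Integrable (fun ω => l (g (Z s ω)) (g (Z t ω))) P)
    {s t : Fin n} (hst : s ≠ t) :
    ∫ ω, kernelDist P k (fun r ω => f (Z r ω)) s t ω
      * kernelDist P l (fun r ω => g (Z r ω)) s t ω ∂P = 0 := by
  have hνP : IsProbabilityMeasure ν := hν s ▸ Measure.isProbabilityMeasure_map (hZ s).aemeasurable
  have : IsProbabilityMeasure (ν.map f) := Measure.isProbabilityMeasure_map hf.aemeasurable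
  have : IsProbabilityMeasure (ν.map g) := Measure.isProbabilityMeasure_map hg.aemeasurable
  have hfm (r) : Measurable fun ω => f (Z r ω) := hf.comp (hZ r)
  have hgm (r) : Measurable fun ω => g (Z r ω) := hg.comp (hZ r)
  have hfν (r) : P.map (fun ω => f (Z r ω)) = ν.map f := by
    rw [← hν r, Measure.map_map hf (hZ r)]; rfl
  have hgν (r) : P.map (fun ω => g (Z r ω)) = ν.map g := by
    rw [← hν r, Measure.map_map hg (hZ r)]; rfl
  have h1 := kernelDist_ae_eq (x := fun r ω => f (Z r ω)) hst (hfm s) (hfm t) (hfν s) (hfν t)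
    ((hind.indepFun hst).comp hf hf) hk hk_symm (hkint s t hst)
  have h2 := kernelDist_ae_eq (x := fun r ω => g (Z r ω)) hst (hgm s) (hgm t) (hgν s) (hgν t)
    ((hind.indepFun hst).comp hg hg) hl hl_symm (hlint s t hst)
  refine (integral_congr_ae (h1.mul h2)).trans ?_
  have hmk := measurable_doubleCenter (μ := ν.map f) hk
  have hml := measurable_doubleCenter (μ := ν.map g) hl
  refine integral_eq_zero_of_indepFun (hZ s) (hZ t) (hind.indepFun hst)
    (G := fun w => doubleCenter (ν.map f) k (f w.1) (f w.2)
      * doubleCenter (ν.map g) l (g w.1) (g w.2))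
    ((hmk.comp ((hf.comp measurable_fst).prodMk (hf.comp measurable_snd))).mul
      (hml.comp ((hg.comp measurable_fst).prodMk (hg.comp measurable_snd)))) ?_
  have h3 := integral_doubleCenter hk_symm (integrable_kernel_prod (hfm s) (hfm t) (hfν s) (hfν t)
    ((hind.indepFun hst).comp hf hf) hk (hkint s t hst))
  rw [hν t, hν s]
  filter_upwards [ae_of_ae_map hf.aemeasurable h3] with v hv
  have hm1 : Measurable fun x => doubleCenter (ν.map f) k x (f v) :=
    hmk.comp (measurable_id.prodMk measurable_const)
  have hm2 : Measurable fun x => doubleCenter (ν.map g) l x (g v) :=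
    hml.comp (measurable_id.prodMk measurable_const)
  rw [integral_map hf.aemeasurable hm1.aestronglyMeasurable] at hv
  have h6 := (hfg.comp hm1 hm2).integral_mul_eq_mul_integral
    (hm1.comp hf).aestronglyMeasurable (hm2.comp hg).aestronglyMeasurable
  simp only [Function.comp_def, Pi.mul_apply] at h6
  rw [h6, hv, zero_mul]

end DoubleCenter

/-! ### Passing to the limit in distribution functions. -/

section Portmanteau

open Matrix

variable {ι : Type*} [Fintype ι]

lemma gram_nonneg (a b : ι → ℝ) : 0 ≤ (a ⬝ᵥ a) * (b ⬝ᵥ b) - (a ⬝ᵥ b) ^ 2 := by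
  have h := Finset.sum_mul_sq_le_sq_mul_sq Finset.univ a b
  simp only [pow_two (a _), pow_two (b _)] at h
  exact sub_nonneg.2 h

lemma continuousAt_tStat (m : ℕ) (r : ℝ) {x : (ι → ℝ) × (ι → ℝ)}
    (hx : (x.1 ⬝ᵥ x.1) * (x.2 ⬝ᵥ x.2) - (x.1 ⬝ᵥ x.2) ^ 2 ≠ 0) :
    ContinuousAt (fun x : (ι → ℝ) × (ι → ℝ) => tStat m r x.1 x.2) x := by
  have h : √((x.1 ⬝ᵥ x.1) * (x.2 ⬝ᵥ x.2) - (x.1 ⬝ᵥ x.2) ^ 2) ≠ 0 :=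
    (Real.sqrt_pos.2 ((gram_nonneg _ _).lt_of_ne' hx)).ne'
  unfold tStat
  unfold dotProduct at *
  refine ContinuousAt.mul continuousAt_const (ContinuousAt.div ?_ ?_ h)
  · exact Continuous.continuousAt (by fun_prop)
  · exact Continuous.continuousAt (by fun_prop)

lemma continuous_standardize {κ : Type*} (U : Matrix κ ι ℝ) (σx σy φ : ℝ) :
    Continuous (standardize U σx σy φ) := by
  unfold standardize mulVec dotProduct
  fun_prop

/-- Where the Gram determinant is nonzero the statistic is continuous, so a strict inequality with
`t` persists nearby and the point is not on the frontier. -/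
lemma frontier_setOf_tStat_le_subset {E : Type*} [TopologicalSpace E]
    {S : E → (ι → ℝ) × (ι → ℝ)} (hS : Continuous S) (m : ℕ) (r t : ℝ) :
    frontier {z | tStat m r (S z).1 (S z).2 ≤ t} ⊆
      S ⁻¹' ({x | (x.1 ⬝ᵥ x.1) * (x.2 ⬝ᵥ x.2) - (x.1 ⬝ᵥ x.2) ^ 2 = 0} ∪
        {x | tStat m r x.1 x.2 = t}) := by
  intro z hz
  by_contra hcon
  simp only [Set.preimage_union, Set.mem_union, Set.mem_preimage, not_or] at hcon
  have hc : ContinuousAt (fun z => tStat m r (S z).1 (S z).2) z :=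
    (continuousAt_tStat m r hcon.1).comp hS.continuousAt
  rw [frontier_eq_closure_inter_closure] at hz
  rcases lt_or_gt_of_ne hcon.2 with h | h
  · exact mem_closure_iff_frequently.1 hz.2 ((hc.eventually_lt continuousAt_const h).mono
      fun y hy hy' => hy' hy.le)
  · exact mem_closure_iff_frequently.1 hz.1 ((continuousAt_const.eventually_lt hc h).mono
      fun y hy hy' => absurd hy (not_lt.2 hy'))

theorem tendsto_corStat_le {Ω : ℕ × ℕ → Type*} [∀ d, MeasurableSpace (Ω d)]
    {P : ∀ d, Measure (Ω d)} [∀ d, IsProbabilityMeasure (P d)]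
    {γ : Measure ((ι → ℝ) × (ι → ℝ))} [IsProbabilityMeasure γ]
    {X : ∀ d, Ω d → (ι → ℝ) × (ι → ℝ)} {m : ℕ} (hm : m ≠ 0) {U : Matrix (Fin (m + 1)) ι ℝ}
    {σx σy φ : ℝ} (hσx : 0 < σx) (hσy : 0 < σy) (hφ0 : 0 ≤ φ) (hφ1 : φ < 1)
    (hγ : γ.map (standardize U σx σy φ) = (stdPi (Fin (m + 1))).prod (stdPi (Fin (m + 1))))
    (hX : TendstoInDistribution X atTop (fun z => z) P γ) (t : ℝ) :
    Tendsto (fun d => (P d).real {ω | corStat m (U *ᵥ (X d ω).1) (U *ᵥ (X d ω).2) ≤ t})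
      atTop (𝓝 (∫ w, (noncentralT m w).real (Set.Iic t) ∂(lawW φ (m + 1)))) := by
  set r := φ / √(1 - φ ^ 2)
  have hr : 0 ≤ r := by positivity
  have hS := continuous_standardize U σx σy φ
  simp only [corStat_eq_tStat m U hσx hσy hφ0 hφ1]
  set A : Set ((ι → ℝ) × (ι → ℝ)) :=
    {z | tStat m r (standardize U σx σy φ z).1 (standardize U σx σy φ z).2 ≤ t}
  have hA : MeasurableSet A := ((measurable_tStat m r).comp hS.measurable) measurableSet_Iic
  have hnull : γ (frontier A) = 0 := by
    refine measure_mono_null (frontier_setOf_tStat_le_subset hS m r t) ?_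
    rw [← Measure.map_apply hS.measurable, hγ, prod_stdPi_degenerate hm hr t]
    unfold dotProduct
    exact (measurableSet_eq_fun (by fun_prop) (by fun_prop)).union
      (measurableSet_eq_fun (measurable_tStat m r) measurable_const)
  have hval : ∫ w, (noncentralT m w).real (Set.Iic t) ∂(lawW φ (m + 1)) = γ.real A := by
    have hmeas : MeasurableSet {x : (Fin (m + 1) → ℝ) × (Fin (m + 1) → ℝ) |
        tStat m r x.1 x.2 ≤ t} := measurable_tStat m r measurableSet_Iic
    rw [← prod_stdPi_tStat_le m hφ0 hφ1 t, ← hγ]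
    exact map_measureReal_apply hS.measurable hmeas
  have key := ProbabilityMeasure.tendsto_measure_of_null_frontier_of_tendsto' hX.tendsto
    (E := A) (by simpa using hnull)
  rw [hval]
  simp only [ProbabilityMeasure.coe_mk, Measure.map_id'] at key
  refine ((ENNReal.tendsto_toReal (measure_ne_top γ A)).comp key).congr fun d => ?_
  rw [Function.comp_apply, Measure.map_apply_of_aemeasurable (hX.forall_aemeasurable d) hA]
  rfl

end Portmanteau

/-! ### The studentized statistic in orthonormal coordinates. -/

section Statistic

open Matrix

lemma div_sqrt_studentize {x a b : ℝ} (ha : 0 ≤ a) (hb : 0 ≤ b) (hx : x ^ 2 ≤ a * b) {c : ℝ}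
    (hc : 0 < c) :
    c * x / √(c * a * (c * b)) / √(1 - (c * x / √(c * a * (c * b))) ^ 2)
      = x / √(a * b - x ^ 2) := by
  have hab : 0 ≤ a * b := mul_nonneg ha hb
  have h1 : √(c * a * (c * b)) = c * √(a * b) := by
    rw [show c * a * (c * b) = c ^ 2 * (a * b) by ring, Real.sqrt_mul (sq_nonneg c),
      Real.sqrt_sq hc.le]
  rw [h1, mul_div_mul_left _ _ hc.ne']
  -- If a b = 0, Cauchy–Schwarz gives x = 0 and both sides are 0, whatever the values of the zero
  -- denominators.
  rcases hab.eq_or_lt with h0 | hpos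
  · have : x = 0 := by nlinarith
    simp [this]
  · have h2 : 1 - (x / √(a * b)) ^ 2 = (a * b - x ^ 2) / (a * b) := by
      rw [div_pow, Real.sq_sqrt hab, sub_div, div_self hpos.ne']
    rw [h2, Real.sqrt_div (by linarith), div_div_div_cancel_right₀]
    exact (Real.sqrt_pos.2 hpos).ne'

variable {Ω : Type*} [MeasurableSpace Ω] {P : Measure Ω} {n p q : ℕ} {k l : ℝ → ℝ → ℝ}

lemma kernelMat_eq_symMat (hk : ∀ x y, k x y = k y x) (X : Fin n → Ω → Fin p → ℝ) (i : Fin p)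
    (ω : Ω) : kernelMat P k X i ω = symMat fun e => kernelMat P k X i ω e.1.1 e.1.2 :=
  eq_symMat (fun s t => kernelDist_comm hk (fun r ω' => X r ω' i) s t ω) fun _ => if_pos rfl

lemma normSum_eq (X : Fin n → Ω → Fin p → ℝ) (ω : Ω) : normSum P k X ω
    = (1 / √(p : ℝ)) • ∑ i, fun e : Pairs n => kernelMat P k X i ω e.1.1 e.1.2 := by
  ext e
  simp [normSum, Finset.sum_apply]

/-- Bilinearity: the double sum over coordinates is the product of the two normalized sums, since
1/√(pq) = 1/√p · 1/√q. -/
lemma uCov_eq {v : ℕ} {W : Matrix (Fin v) (Pairs n) ℝ} {r : ℝ}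
    (hW : ∀ c d : Pairs n → ℝ, uInner (uCenter (symMat c)) (uCenter (symMat d))
      = r * ((W *ᵥ c) ⬝ᵥ (W *ᵥ d)))
    (hk : ∀ x y, k x y = k y x) (hl : ∀ x y, l x y = l y x)
    (X : Fin n → Ω → Fin p → ℝ) (Y : Fin n → Ω → Fin q → ℝ) (ω : Ω) :
    uCov P k l X Y ω = r * ((W *ᵥ normSum P k X ω) ⬝ᵥ (W *ᵥ normSum P l Y ω)) := by
  rw [normSum_eq, normSum_eq, mulVec_smul, mulVec_smul, smul_dotProduct, dotProduct_smul,
    mulVec_sum, mulVec_sum, sum_dotProduct]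
  simp only [dotProduct_sum, uCov, smul_eq_mul]
  have h (i : Fin p) (j : Fin q) : uInner (uCenter (kernelMat P k X i ω))
      (uCenter (kernelMat P l Y j ω))
      = r * ((W *ᵥ fun e => kernelMat P k X i ω e.1.1 e.1.2) ⬝ᵥ
        (W *ᵥ fun e => kernelMat P l Y j ω e.1.1 e.1.2)) := by
    rw [← hW, ← kernelMat_eq_symMat hk, ← kernelMat_eq_symMat hl]
  simp only [h, ← Finset.mul_sum]
  rw [Real.sqrt_mul (Nat.cast_nonneg p)]
  ring

lemma studentized_eq_corStat {m : ℕ} (hm : dof n = m + 1) {W : Matrix (Fin (m + 1)) (Pairs n) ℝ}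
    (hW : ∀ c d : Pairs n → ℝ, uInner (uCenter (symMat c)) (uCenter (symMat d))
      = ((m + 1 : ℕ) : ℝ)⁻¹ * ((W *ᵥ c) ⬝ᵥ (W *ᵥ d)))
    (hk : ∀ x y, k x y = k y x) (hl : ∀ x y, l x y = l y x)
    (X : Fin n → Ω → Fin p → ℝ) (Y : Fin n → Ω → Fin q → ℝ) (ω : Ω) :
    studentized P k l X Y ω
      = corStat m (W *ᵥ normSum P k X ω) (W *ᵥ normSum P l Y ω) := by
  rw [studentized, uCor, uCov_eq hW hk hl, uCov_eq hW hk hk, uCov_eq hW hl hl,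
    div_sqrt_studentize, corStat, hm]
  · push_cast
    rw [add_sub_cancel_right]
  · exact Finset.sum_nonneg fun _ _ => mul_self_nonneg _
  · exact Finset.sum_nonneg fun _ _ => mul_self_nonneg _
  · exact sub_nonneg.1 (gram_nonneg _ _)
  · positivity

end Statistic

/-! ### Second moments of the normalized sums. -/

section Moments

variable {Ω : Type*} [MeasurableSpace Ω] {P : Measure Ω}

lemma integral_sum_mul_sum {ι κ : Type*} [Fintype ι] [Fintype κ] {A : ι → Ω → ℝ}
    {B : κ → Ω → ℝ} (hA : ∀ i, MemLp (A i) 2 P) (hB : ∀ j, MemLp (B j) 2 P) (a b : ℝ) :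
    ∫ ω, (a * ∑ i, A i ω) * (b * ∑ j, B j ω) ∂P
      = a * b * ∑ i, ∑ j, ∫ ω, A i ω * B j ω ∂P := by
  have h (ω : Ω) : (a * ∑ i, A i ω) * (b * ∑ j, B j ω)
      = a * b * ∑ i, ∑ j, A i ω * B j ω := by
    rw [← Finset.sum_mul_sum]
    ring
  have hAB (i j) : Integrable (fun ω => A i ω * B j ω) P := (hA i).integrable_mul (hB j)
  simp only [h]
  rw [integral_const_mul, integral_finsetSum _ fun i _ => integrable_finsetSum _ fun j _ => hAB i j]
  congr 1
  exact Finset.sum_congr rfl fun i _ => integral_finsetSum _ fun j _ => hAB i j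

variable {n p q : ℕ} {k l : ℝ → ℝ → ℝ} {X : Fin n → Ω → Fin p → ℝ} {Y : Fin n → Ω → Fin q → ℝ}

lemma memLp_normSum (hkX : ∀ s t : Fin n, s ≠ t → ∀ i,
      MemLp (fun ω => kernelMat P k X i ω s t) 2 P) (e : Pairs n) :
    MemLp (fun ω => normSum P k X ω e) 2 P :=
  (memLp_finsetSum _ fun i _ => hkX _ _ e.2.ne i).const_mul _

variable [IsProbabilityMeasure P]

lemma covariance_eq_integral_mul {A B : Ω → ℝ} (hA : MemLp A 2 P) (hB : MemLp B 2 P)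
    (hA0 : ∫ ω, A ω ∂P = 0) : cov[A, B; P] = ∫ ω, A ω * B ω ∂P := by
  rw [covariance_eq_sub hA hB, hA0, zero_mul, sub_zero]
  rfl

/-- The summands are centered, so the second moment is exactly the quantity whose limit the central
limit assumption prescribes. -/
lemma integral_normSum_sq (hX : ∀ s, Measurable (X s))
    (hint : ∀ s t : Fin n, s ≠ t → ∀ i, Integrable (fun ω => k (X s ω i) (X t ω i)) P)
    (hkX : ∀ s t : Fin n, s ≠ t → ∀ i, MemLp (fun ω => kernelMat P k X i ω s t) 2 P)
    (e : Pairs n) :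
    ∫ ω, normSum P k X ω e ^ 2 ∂P = 1 / (p : ℝ) * ∑ i, ∑ j,
      cov[fun ω => kernelMat P k X i ω e.1.1 e.1.2,
        fun ω => kernelMat P k X j ω e.1.1 e.1.2; P] := by
  have h (i j) : cov[fun ω => kernelMat P k X i ω e.1.1 e.1.2,
      fun ω => kernelMat P k X j ω e.1.1 e.1.2; P]
      = ∫ ω, kernelMat P k X i ω e.1.1 e.1.2 * kernelMat P k X j ω e.1.1 e.1.2 ∂P :=
    covariance_eq_integral_mul (hkX _ _ e.2.ne i) (hkX _ _ e.2.ne j)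
      (integral_kernelDist (x := fun r ω => X r ω i) ((measurable_pi_apply i).comp (hX _))
        ((measurable_pi_apply i).comp (hX _)) (hint _ _ e.2.ne i))
  simp only [h, pow_two, normSum]
  rw [integral_sum_mul_sum (fun i => hkX _ _ e.2.ne i) (fun i => hkX _ _ e.2.ne i),
    div_mul_div_comm, one_mul, Real.mul_self_sqrt (Nat.cast_nonneg p)]

variable {α : Type*} [MeasurableSpace α] {Z : Fin n → Ω → α} {ν : Measure α} {f g : α → ℝ}

lemma integral_kernelDist_mul_of_pair_ne (hZ : ∀ s, Measurable (Z s)) (hind : iIndepFun Z P)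
    (hν : ∀ s, P.map (Z s) = ν) (hf : Measurable f) (hg : Measurable g)
    (hk : Measurable (Function.uncurry k)) (hl : Measurable (Function.uncurry l))
    (hk_symm : ∀ x y, k x y = k y x) (hl_symm : ∀ x y, l x y = l y x)
    (hkint : ∀ s t, s ≠ t → Integrable (fun ω => k (f (Z s ω)) (f (Z t ω))) P)
    (hlint : ∀ s t, s ≠ t → Integrable (fun ω => l (g (Z s ω)) (g (Z t ω))) P)
    {e e' : Pairs n} (hee : e ≠ e') :
    ∫ ω, kernelDist P k (fun r ω => f (Z r ω)) e.1.1 e.1.2 ω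
      * kernelDist P l (fun r ω => g (Z r ω)) e'.1.1 e'.1.2 ω ∂P = 0 := by
  by_cases h1 : e.1.1 ≠ e'.1.1 ∧ e.1.1 ≠ e'.1.2
  · exact integral_kernelDist_mul_of_ne hZ hind hν hf hg hk hl hk_symm hl_symm hkint hlint
      e.2.ne e'.2.ne h1.1 h1.2
  · have h2 : e.1.2 ≠ e'.1.1 ∧ e.1.2 ≠ e'.1.2 := by
      obtain ⟨⟨s, t⟩, hst⟩ := e
      obtain ⟨⟨a, b⟩, hab⟩ := e'
      simp only [ne_eq, Subtype.mk.injEq, Prod.mk.injEq] at hee h1 hst hab ⊢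
      omega
    simp only [kernelDist_comm hk_symm _ e.1.1 e.1.2]
    exact integral_kernelDist_mul_of_ne hZ hind hν hf hg hk hl hk_symm hl_symm hkint hlint
      e.2.ne' e'.2.ne h2.1 h2.2

end Moments

/-! ### Identification of the limit and conclusion. -/

section Assembly

open Matrix

lemma indepFun_map {Ω α : Type*} [MeasurableSpace Ω] [MeasurableSpace α] {P : Measure Ω}
    [IsProbabilityMeasure P] {Z : Ω → α} (hZ : Measurable Z) {f g : α → ℝ} (hf : Measurable f)
    (hg : Measurable g) (h : IndepFun (fun ω => f (Z ω)) (fun ω => g (Z ω)) P) :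
    IndepFun f g (P.map Z) := by
  have : IsProbabilityMeasure (P.map Z) := Measure.isProbabilityMeasure_map hZ.aemeasurable
  rw [indepFun_iff_map_prod_eq_prod_map_map hf.aemeasurable hg.aemeasurable,
    Measure.map_map (hf.prodMk hg) hZ, Measure.map_map hf hZ, Measure.map_map hg hZ]
  exact (indepFun_iff_map_prod_eq_prod_map_map (hf.comp hZ).aemeasurable
    (hg.comp hZ).aemeasurable).1 h

lemma lawW_zero (v : ℕ) : lawW 0 v = Measure.dirac 0 := by
  simp [lawW]

lemma noncentralT_zero (m : ℕ) : noncentralT m 0 = studentT m := by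
  simp [noncentralT, studentT]

lemma integral_noncentralT_lawW_zero (m v : ℕ) (t : ℝ) :
    ∫ w, (noncentralT m w).real (Set.Iic t) ∂(lawW 0 v) = (studentT m).real (Set.Iic t) := by
  rw [lawW_zero, integral_dirac, noncentralT_zero]

section Sample

variable {Ω : Type*} [MeasurableSpace Ω] {P : Measure Ω} {n p q : ℕ}
  {X : Fin n → Ω → Fin p → ℝ} {Y : Fin n → Ω → Fin q → ℝ} {k l : ℝ → ℝ → ℝ}

lemma IsIIDSample.measurable_pair (h : IsIIDSample P X Y) (s : Fin n) :
    Measurable fun ω => (X s ω, Y s ω) :=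
  (h.measurable_X s).prodMk (h.measurable_Y s)

lemma integral_normSum_mul_of_ne {p' q' : ℕ} {X' : Fin n → Ω → Fin p' → ℝ}
    {Y' : Fin n → Ω → Fin q' → ℝ}
    (hkX : ∀ s t : Fin n, s ≠ t → ∀ i, MemLp (fun ω => kernelMat P k X' i ω s t) 2 P)
    (hlY : ∀ s t : Fin n, s ≠ t → ∀ i, MemLp (fun ω => kernelMat P l Y' i ω s t) 2 P)
    {e e' : Pairs n} (h : ∀ i j, ∫ ω, kernelMat P k X' i ω e.1.1 e.1.2
      * kernelMat P l Y' j ω e'.1.1 e'.1.2 ∂P = 0) :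
    ∫ ω, normSum P k X' ω e * normSum P l Y' ω e' ∂P = 0 := by
  simp only [normSum]
  rw [integral_sum_mul_sum (fun i => hkX _ _ e.2.ne i) (fun i => hlY _ _ e'.2.ne i)]
  simp [h]

end Sample

variable {n : ℕ} {Ω : ℕ × ℕ → Type*} [∀ d, MeasurableSpace (Ω d)]
  {P : ∀ d, Measure (Ω d)} [∀ d, IsProbabilityMeasure (P d)]
  {X : ∀ d : ℕ × ℕ, Fin n → Ω d → Fin d.1 → ℝ} {Y : ∀ d : ℕ × ℕ, Fin n → Ω d → Fin d.2 → ℝ}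
  {k l : ℝ → ℝ → ℝ} {σx σy σxy φ : ℝ}

/-- Under the central limit assumption, the standardized limit vectors are independent standard
Gaussian vectors. -/
lemma KernelCLT.exists_limit {κ : Type*} [Fintype κ] [DecidableEq κ] [NeZero n]
    (hCLT : KernelCLT P k l X Y σx σy σxy)
    (hXY : ∀ d, IsIIDSample (P d) (X d) (Y d))
    (hk : Measurable (Function.uncurry k)) (hl : Measurable (Function.uncurry l))
    (hk_symm : ∀ x y, k x y = k y x) (hl_symm : ∀ x y, l x y = l y x)
    (hkX : KernelMoments P k X) (hlY : KernelMoments P l Y)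
    (hσx : 0 < σx) (hσy : 0 < σy) (hφ : σxy ^ 2 = φ * (σx * σy)) (hφ0 : 0 ≤ φ) (hφ1 : φ < 1) :
    ∃ (γ : Measure ((Pairs n → ℝ) × (Pairs n → ℝ))) (_ : IsProbabilityMeasure γ),
      TendstoInDistribution
        (fun d ω => (normSum (P d) k (X d) ω, normSum (P d) l (Y d) ω))
        atTop (fun z => z) P γ ∧
      ∀ W : Matrix κ (Pairs n) ℝ, W * Wᵀ = 1 →
        γ.map (standardize W σx σy φ) = (stdPi κ).prod (stdPi κ) := by
  obtain ⟨γ, hγ, hT, hvar⟩ := hCLT.tendsto_gaussian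
  refine ⟨γ, inferInstance, hT, fun W hW => ?_⟩
  have hid : HasGaussianLaw (fun z : (Pairs n → ℝ) × (Pairs n → ℝ) => z) γ :=
    IsGaussian.hasGaussianLaw_id
  have hm (d) (s : Fin n) := (hXY d).measurable_pair s
  have hν (d) (s : Fin n) : (P d).map (fun ω => (X d s ω, Y d s ω))
      = (P d).map (fun ω => (X d 0 ω, Y d 0 ω)) := ((hXY d).identDistrib s 0).map_eq
  have hX2 (d) (s t : Fin n) (h : s ≠ t) (i) := (hkX d s t h i).2
  have hY2 (d) (s t : Fin n) (h : s ≠ t) (i) := (hlY d s t h i).2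
  have hX1 (d) (s t : Fin n) (h : s ≠ t) (i) := (hkX d s t h i).1
  have hY1 (d) (s t : Fin n) (h : s ≠ t) (i) := (hlY d s t h i).1
  have hf (d : ℕ × ℕ) (i : Fin d.1) :
      Measurable fun z : (Fin d.1 → ℝ) × (Fin d.2 → ℝ) => z.1 i := by fun_prop
  have hg (d : ℕ × ℕ) (j : Fin d.2) :
      Measurable fun z : (Fin d.1 → ℝ) × (Fin d.2 → ℝ) => z.2 j := by fun_prop
  have oXX (d) {e e' : Pairs n} (h : e ≠ e') := integral_normSum_mul_of_ne (hX2 d) (hX2 d)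
    fun i j => integral_kernelDist_mul_of_pair_ne (hm d) (hXY d).indep (hν d) (hf d i) (hf d j)
      hk hk hk_symm hk_symm (fun s t h => hX1 d s t h i) (fun s t h => hX1 d s t h j) h
  have oXY (d) {e e' : Pairs n} (h : e ≠ e') := integral_normSum_mul_of_ne (hX2 d) (hY2 d)
    fun i j => integral_kernelDist_mul_of_pair_ne (hm d) (hXY d).indep (hν d) (hf d i) (hg d j)
      hk hl hk_symm hl_symm (fun s t h => hX1 d s t h i) (fun s t h => hY1 d s t h j) h
  have oYY (d) {e e' : Pairs n} (h : e ≠ e') := integral_normSum_mul_of_ne (hY2 d) (hY2 d)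
    fun i j => integral_kernelDist_mul_of_pair_ne (hm d) (hXY d).indep (hν d) (hg d i) (hg d j)
      hl hl hl_symm hl_symm (fun s t h => hY1 d s t h i) (fun s t h => hY1 d s t h j) h
  have limX (e : Pairs n) : Tendsto (fun d => ∫ ω, normSum (P d) k (X d) ω e ^ 2 ∂(P d)) atTop
      (𝓝 Var[fun z : (Pairs n → ℝ) × (Pairs n → ℝ) => z.1 e; γ]) := by
    rw [(hvar e).1]
    exact (hCLT.tendsto_x e.1.1 e.1.2 e.2).congr fun d =>
      (integral_normSum_sq (hXY d).measurable_X (hX1 d) (hX2 d) e).symm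
  have limY (e : Pairs n) : Tendsto (fun d => ∫ ω, normSum (P d) l (Y d) ω e ^ 2 ∂(P d)) atTop
      (𝓝 Var[fun z : (Pairs n → ℝ) × (Pairs n → ℝ) => z.2 e; γ]) := by
    rw [(hvar e).2.1]
    exact (hCLT.tendsto_y e.1.1 e.1.2 e.2).congr fun d =>
      (integral_normSum_sq (hXY d).measurable_Y (hY1 d) (hY2 d) e).symm
  have c1 (e : Pairs n) : Continuous fun z : (Pairs n → ℝ) × (Pairs n → ℝ) => z.1 e := by fun_prop
  have c2 (e : Pairs n) : Continuous fun z : (Pairs n → ℝ) × (Pairs n → ℝ) => z.2 e := by fun_prop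
  have M1 (e) := (hid.fst.eval e).memLp_two
  have M2 (e) := (hid.snd.eval e).memLp_two
  have N1 (e) := fun d => memLp_normSum (hX2 d) e
  have N2 (e) := fun d => memLp_normSum (hY2 d) e
  refine map_standardize hW hσx hσy hφ0 hφ1
    (fun e => integral_limit_eq_zero hT (c1 e) (M1 e) (N1 e) (limX e))
    (fun e => integral_limit_eq_zero hT (c2 e) (M2 e) (N2 e) (limY e))
    (fun e e' => ?_) (fun e e' => ?_) (fun e e' => ?_)
  -- On the diagonal the covariances are part of the assumption; off it they vanish because the sums
  -- are uncorrelated before the limit.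
  all_goals
    rcases eq_or_ne e e' with rfl | h
  · rw [one_apply_eq, mul_one, covariance_self (c1 e).aemeasurable, (hvar e).1]
  · rw [one_apply_ne h, mul_zero]
    exact covariance_limit_eq_zero hT (c1 e) (c1 e') (M1 e) (M1 e') (N1 e) (N1 e') (limX e)
      (limX e') fun d => oXX d h
  · rw [one_apply_eq, mul_one, covariance_self (c2 e).aemeasurable, (hvar e).2.1]
  · rw [one_apply_ne h, mul_zero]
    exact covariance_limit_eq_zero hT (c2 e) (c2 e') (M2 e) (M2 e') (N2 e) (N2 e') (limY e)
      (limY e') fun d => oYY d h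
  · rw [one_apply_eq, mul_one, (hvar e).2.2, hφ]
  · rw [one_apply_ne h, mul_zero]
    exact covariance_limit_eq_zero hT (c1 e) (c2 e') (M1 e) (M2 e') (N1 e) (N2 e') (limX e)
      (limY e') fun d => oXY d h

/-- σxy² is the limit of averaged covariances, each of which is 0 under independence. -/
lemma KernelCLT.eq_zero_of_indepFun (hn : 2 ≤ n)
    (hCLT : KernelCLT P k l X Y σx σy σxy)
    (hXY : ∀ d, IsIIDSample (P d) (X d) (Y d))
    (hk : Measurable (Function.uncurry k)) (hl : Measurable (Function.uncurry l))
    (hk_symm : ∀ x y, k x y = k y x) (hl_symm : ∀ x y, l x y = l y x)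
    (hkX : KernelMoments P k X) (hlY : KernelMoments P l Y)
    (hind : ∀ d s, IndepFun (X d s) (Y d s) (P d)) : σxy ^ 2 = 0 := by
  let s : Fin n := ⟨0, by omega⟩
  let t : Fin n := ⟨1, by omega⟩
  have hst : s < t := by simp [s, t]
  refine tendsto_nhds_unique (hCLT.tendsto_xy s t hst) (tendsto_const_nhds.congr fun d => ?_)
  have hm := (hXY d).measurable_pair
  have h (i : Fin d.1) (j : Fin d.2) : cov[fun ω => kernelMat (P d) k (X d) i ω s t,
      fun ω => kernelMat (P d) l (Y d) j ω s t; P d] = 0 := by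
    rw [covariance_eq_integral_mul (hkX d s t hst.ne i).2 (hlY d s t hst.ne j).2
      (integral_kernelDist (x := fun r ω => X d r ω i)
        ((measurable_pi_apply i).comp ((hXY d).measurable_X s))
        ((measurable_pi_apply i).comp ((hXY d).measurable_X t)) (hkX d s t hst.ne i).1)]
    have hf : Measurable fun z : (Fin d.1 → ℝ) × (Fin d.2 → ℝ) => z.1 i := by fun_prop
    have hg : Measurable fun z : (Fin d.1 → ℝ) × (Fin d.2 → ℝ) => z.2 j := by fun_prop
    exact integral_kernelDist_mul_of_indepFun hm (hXY d).indep
      (fun r => ((hXY d).identDistrib r s).map_eq) hf hg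
      (indepFun_map (hm s) hf hg
        ((hind d s).comp (measurable_pi_apply i) (measurable_pi_apply j)))
      hk hl hk_symm hl_symm (fun r r' hr => (hkX d r r' hr i).1)
      (fun r r' hr => (hlY d r r' hr j).1) hst.ne
  simp [h]

/-- Ensures v - 1 ≥ 1, without which the limiting Gram determinant would vanish. -/
lemma two_le_dof (hn : 4 ≤ n) : 2 ≤ dof n := by
  have h4 : (4 : ℝ) ≤ n := by exact_mod_cast hn
  have : (2 : ℝ) ≤ dof n := by
    rw [dof_cast (by omega)]
    nlinarith
  exact_mod_cast this

theorem tendsto_studentized_le (hn : 4 ≤ n)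
    (hCLT : KernelCLT P k l X Y σx σy σxy)
    (hXY : ∀ d, IsIIDSample (P d) (X d) (Y d))
    (hk : Measurable (Function.uncurry k)) (hl : Measurable (Function.uncurry l))
    (hk_symm : ∀ x y, k x y = k y x) (hl_symm : ∀ x y, l x y = l y x)
    (hkX : KernelMoments P k X) (hlY : KernelMoments P l Y)
    (hσx : 0 < σx) (hσy : 0 < σy) (hφ : σxy ^ 2 = φ * (σx * σy)) (hφ0 : 0 ≤ φ) (hφ1 : φ < 1)
    (t : ℝ) :
    Tendsto (fun d => (P d).real {ω | studentized (P d) k l (X d) (Y d) ω ≤ t})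
      atTop (𝓝 (∫ w, (noncentralT (dof n - 1) w).real (Set.Iic t) ∂(lawW φ (dof n)))) := by
  have : NeZero n := ⟨by omega⟩
  have hW := exists_orthonormal_coordinates hn
  obtain ⟨m, hm⟩ : ∃ m, dof n = m + 1 := ⟨dof n - 1, by have := two_le_dof hn; omega⟩
  have hm0 : m ≠ 0 := by have := two_le_dof hn; omega
  rw [hm] at hW ⊢
  obtain ⟨W, hW1, hW2⟩ := hW
  obtain ⟨γ, hγ, hT, hstd⟩ := hCLT.exists_limit (κ := Fin (m + 1)) hXY hk hl hk_symm
    hl_symm hkX hlY hσx hσy hφ hφ0 hφ1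
  rw [Nat.add_sub_cancel]
  simp only [studentized_eq_corStat hm hW2 hk_symm hl_symm]
  exact tendsto_corStat_le hm0 hσx hσy hφ0 hφ1 (hstd W hW1) hT t

end Assembly

end HDIndep

theorem proposition3 {n : ℕ} (hn : 4 ≤ n)
    {Ω : ℕ × ℕ → Type*} [∀ d, MeasurableSpace (Ω d)]
    (P : ∀ d, Measure (Ω d)) [∀ d, IsProbabilityMeasure (P d)]
    (X : ∀ d : ℕ × ℕ, Fin n → Ω d → Fin d.1 → ℝ)
    (Y : ∀ d : ℕ × ℕ, Fin n → Ω d → Fin d.2 → ℝ)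
    (hXY : ∀ d, IsIIDSample (P d) (X d) (Y d))
    (k l : ℝ → ℝ → ℝ)
    (hk : Measurable (Function.uncurry k)) (hl : Measurable (Function.uncurry l))
    (hk_symm : ∀ x y, k x y = k y x) (hl_symm : ∀ x y, l x y = l y x)
    (hX_bdd : BoundedMoments P X) (hY_bdd : BoundedMoments P Y)
    (hkX : KernelMoments P k X) (hlY : KernelMoments P l Y)
    (σx σy σxy φ : ℝ) (hσx : 0 < σx) (hσy : 0 < σy)
    (hCLT : KernelCLT P k l X Y σx σy σxy)
    (hφ : φ = σxy ^ 2 / √(σx ^ 2 * σy ^ 2)) (hφ_lt : φ < 1) :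
    ((∀ d s, IndepFun (X d s) (Y d s) (P d)) →
      ∀ t : ℝ, Tendsto
        (fun d : ℕ × ℕ => (P d).real {ω | studentized (P d) k l (X d) (Y d) ω ≤ t})
        atTop (𝓝 ((studentT (dof n - 1)).real (Set.Iic t)))) ∧
    (∀ t : ℝ, Tendsto
      (fun d : ℕ × ℕ => (P d).real {ω | studentized (P d) k l (X d) (Y d) ω ≤ t})
      atTop (𝓝 (∫ w, (noncentralT (dof n - 1) w).real (Set.Iic t) ∂(lawW φ (dof n))))) := by
  have hσ : 0 < σx * σy := mul_pos hσx hσy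
  have hφ' : φ = σxy ^ 2 / (σx * σy) := by
    rw [hφ, ← mul_pow, Real.sqrt_sq hσ.le]
  have hφ0 : 0 ≤ φ := by
    rw [hφ']
    positivity
  have hcov : σxy ^ 2 = φ * (σx * σy) := by
    rw [hφ', div_mul_cancel₀ _ hσ.ne']
  have main := tendsto_studentized_le hn hCLT hXY hk hl hk_symm hl_symm hkX hlY hσx hσy hcov
    hφ0 hφ_lt
  refine ⟨fun hind t => ?_, main⟩
  -- With φ = 0 the mixing law is the point mass at 0, and the mixture reduces to the central t law.
  have hφz : φ = 0 := by
    rw [hφ', hCLT.eq_zero_of_indepFun (by omega) hXY hk hl hk_symm hl_symm hkX hlY hind, zero_div]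
  have h := main t
  rwa [hφz, integral_noncentralT_lawW_zero] at h
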